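/- Let $G$ be a real Lie group with Lie algebra $\mathfrak g$, and let $P=G\times\mathfrak g$ be the trivial principal $G$-bundle over the vector space $\mathfrak g$, with $G$ acting by left multiplication on the first factor. For $\rho\in\mathfrak g$ let $\rho^*$ be the fundamental vector field on $P$. Let $\theta$ be a smooth connection $1$-form on $P$ (so $\theta$ is $\mathfrak g$-valued, $\theta(\rho^*)=\rho$, and $\theta$ is $\mathrm{Ad}$-equivariant) and let $L$ be a smooth $\mathrm{Ad}$-equivariant $\mathfrak g$-valued $1$-form on $P$ whose kernel at each point is exactly the vertical space. Let $I$ be the almost complex structure on $P$ determined by $\theta(IX)=-L(X)$, $L(IX)=\theta(X)$ (equivalently, $I\rho^*$ is the horizontal vector $Y$ with $L(Y)=\rho$, and $I^2=-1$), and assume that $I$ is integrable. Let $\mu:P\to\mathfrak g^*$ be a smooth map, equivariant for the coadjoint action. For $\xi\in\mathfrak g^*$ define $\operatorname{ad}\xi:\mathfrak g\to\mathfrak g^*$ by $\langle\operatorname{ad}\xi(x),y\rangle=\langle\xi,[x,y]\rangle$, and let $D\mu=d\mu+(\operatorname{ad}\mu)\circ\theta$ be the covariant derivative of $\mu$. Assume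 that $\mu$ is regular, i.e. that only vertical vectors are in the kernel of $D\mu$. Then there is a unique function $\Phi$ on $P$ with values in the invertible linear maps $\mathfrak g^*\to\mathfrak g$ such that $L=\Phi(D\mu)$. We regard $\Phi$ at each point as the bilinear form $(x,y)\mapsto\langle x,\Phi(y)\rangle$ on $\mathfrak g^*$. There is a $G$-invariant Kähler metric $g$ on $(P,I)$, with Kähler form $\omega=g(I\cdot,\cdot)$, for which $\mu$ is a moment map (i.e. $d\langle\mu,\rho\rangle=\omega(\rho^*,\cdot)$ for all $\rho\in\mathfrak g$) if and only if, at every point of $P$, $\Phi$ is symmetric and both $\Phi$ and $\Phi+\Phi\circ(\operatorname{ad}\mu\circ\Phi)^2$ are positive definite. In this case every such metric is given, for tangent vectors $X,Y$ at a point of $P$, by $$g(X,Y)=\langle\Phi(D\mu(X)),D\mu(Y)\rangle+\langle\Phi^{-1}(\theta(X)),\theta(Y)\rangle+\big\langle\mu,\,[\Phi(D\mu(X)),\theta(Y)]-[\theta(X),\Phi(D\mu(Y))]\big\rangle,$$ and its Kähler form is $\omega=-d\langle\mu,\theta\rangle$, where $d\alpha(X,Y)=X(\alpha(Y))-Y(\alpha(X))-\alpha([X,Y])$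 for $1$-forms $\alpha$. -/

import Mathlib

open scoped Manifold ContDiff Bundle

noncomputable section

namespace KahlerGC

/-! ### The exterior derivative on a manifold -/

section ExtDeriv

variable {V : Type*} [NormedAddCommGroup V] [NormedSpace ℝ V]
  {H : Type*} [TopologicalSpace H] (J : ModelWithCorners ℝ V H)
  {M : Type*} [TopologicalSpace M] [ChartedSpace H M]

/-- A (not necessarily smooth) real differential `n`-form on a manifold. -/
abbrev DiffForm (n : ℕ) : Type _ := (p : M) → TangentSpace J p [⋀^Fin n]→L[ℝ] ℝ

variable {J}

/-- The expression of a differential form in the preferred chart at `p₀`: the pull-back of the form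
under the inverse of the chart. -/
def DiffForm.inChart {n : ℕ} (α : DiffForm J (M := M) n) (p₀ : M) (y : V) : V [⋀^Fin n]→L[ℝ] ℝ :=
  (α ((extChartAt J p₀).symm y)).compContinuousLinearMap
    (mfderiv 𝓘(ℝ, V) J (extChartAt J p₀).symm y :
      V →L[ℝ] TangentSpace J ((extChartAt J p₀).symm y))

/-- The exterior derivative on a manifold without boundary, computed at `p` in the preferred chart
at `p`; that chart identifies `T_p M` with the model space. The normalization is
`dα(X, Y) = X (α Y) - Y (α X) - α [X, Y]` for `1`-forms. -/
def DiffForm.d {n : ℕ} (α : DiffForm J (M := M) n) : DiffForm J (M := M) (n + 1) :=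
  fun p => (extDeriv (α.inChart p) (extChartAt J p p) : V [⋀^Fin (n + 1)]→L[ℝ] ℝ)

variable (J) in
/-- Integrability of an almost complex structure `I`: its Nijenhuis tensor vanishes. -/
def IsIntegrable [IsManifold J ∞ M] (I : (p : M) → TangentSpace J p →L[ℝ] TangentSpace J p) :
    Prop :=
  ∀ X Y : (p : M) → TangentSpace J p,
    ContMDiff J J.tangent ∞ (fun p => (⟨p, X p⟩ : TangentBundle J M)) →
    ContMDiff J J.tangent ∞ (fun p => (⟨p, Y p⟩ : TangentBundle J M)) →
    ∀ p : M,
      VectorField.mlieBracket J (fun q => I q (X q)) (fun q => I q (Y q)) p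
        - I p (VectorField.mlieBracket J (fun q => I q (X q)) Y p)
        - I p (VectorField.mlieBracket J X (fun q => I q (Y q)) p)
        - VectorField.mlieBracket J X Y p = 0

end ExtDeriv

/-! ### The Lie algebra and the trivial bundle `P = G × 𝔤`

`G` is a Lie group modelled on the finite-dimensional space `E`. In Mathlib its Lie algebra
`GroupLieAlgebra 𝓘(ℝ, E) G`, the tangent space at `1`, is by definition the vector space `E`, with
the bracket of left-invariant vector fields. So `𝔤` is written `E`, its dual `E →L[ℝ] ℝ`, and
`P` is the manifold `G × E`. -/

variable {E : Type*} [NormedAddCommGroup E] [NormedSpace ℝ E] [FiniteDimensional ℝ E]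
  {G : Type*} [TopologicalSpace G] [ChartedSpace E G] [Group G]

/-- The Lie bracket of `𝔤 = T₁G`. -/
def lieBr (G : Type*) [TopologicalSpace G] [ChartedSpace E G] [Group G] (x y : E) : E :=
  Bracket.bracket (L := GroupLieAlgebra 𝓘(ℝ, E) G) (M := GroupLieAlgebra 𝓘(ℝ, E) G) x y

/-- The adjoint action of `g ∈ G` on `𝔤`: the differential at `1` of `h ↦ g h g⁻¹`. -/
def Ad (g : G) : E →L[ℝ] E :=
  (mfderiv 𝓘(ℝ, E) 𝓘(ℝ, E) (fun h : G => g * h * g⁻¹) 1 : _)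

/-- The coadjoint action of `g ∈ G` on `𝔤*`: `⟨Ad*_g ξ, x⟩ = ⟨ξ, Ad_{g⁻¹} x⟩`. -/
def coAd (g : G) (ξ : E →L[ℝ] ℝ) : E →L[ℝ] ℝ := ξ.comp (Ad g⁻¹)

theorem lieGroup_minSmoothness (G : Type*) [TopologicalSpace G] [ChartedSpace E G] [Group G]
    [LieGroup 𝓘(ℝ, E) ∞ G] : LieGroup 𝓘(ℝ, E) (minSmoothness ℝ 3) G :=
  LieGroup.of_le (n := ∞) (by rw [minSmoothness_of_isRCLikeNormedField]; exact ENat.LEInfty.out)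

/-- `ad ξ : 𝔤 → 𝔤*` for `ξ ∈ 𝔤*`, given by `⟨ad ξ (x), y⟩ = ⟨ξ, [x, y]⟩`. -/
def ad (G : Type*) [TopologicalSpace G] [ChartedSpace E G] [Group G] [LieGroup 𝓘(ℝ, E) ∞ G]
    (ξ : E →L[ℝ] ℝ) : E →L[ℝ] (E →L[ℝ] ℝ) :=
  LinearMap.toContinuousLinearMap
    { toFun := fun x => LinearMap.toContinuousLinearMap
        { toFun := fun y => ξ (lieBr G x y)
          map_add' := by
            have := lieGroup_minSmoothness (E := E) G
            intro y z
            rw [← map_add]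
            exact congrArg ξ (lie_add (L := GroupLieAlgebra 𝓘(ℝ, E) G) (M := GroupLieAlgebra 𝓘(ℝ, E) G) _ _ _)
          map_smul' := by
            have := lieGroup_minSmoothness (E := E) G
            intro c y
            rw [RingHom.id_apply, ← map_smul]
            exact congrArg ξ (lie_smul (R := ℝ) (L := GroupLieAlgebra 𝓘(ℝ, E) G)
              (M := GroupLieAlgebra 𝓘(ℝ, E) G) _ _ _) }
      map_add' := by
        have := lieGroup_minSmoothness (E := E) G
        intro x z
        ext y
        change ξ _ = ξ _ + ξ _
        rw [← map_add]
        exact congrArg ξ (add_lie (L := GroupLieAlgebra 𝓘(ℝ, E) G) (M := GroupLieAlgebra 𝓘(ℝ, E) G) _ _ _)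
      map_smul' := by
        have := lieGroup_minSmoothness (E := E) G
        intro c x
        ext y
        change ξ _ = c • ξ _
        rw [← map_smul]
        exact congrArg ξ (smul_lie (R := ℝ) (L := GroupLieAlgebra 𝓘(ℝ, E) G)
              (M := GroupLieAlgebra 𝓘(ℝ, E) G) _ _ _) }

/-- The model with corners of `P = G × 𝔤`. -/
abbrev IP (E : Type*) [NormedAddCommGroup E] [NormedSpace ℝ E] :
    ModelWithCorners ℝ (E × E) (ModelProd E E) :=
  𝓘(ℝ, E).prod 𝓘(ℝ, E)

/-- The tangent space of `P = G × 𝔤` at `p`. -/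
abbrev TP (p : G × E) : Type _ := TangentSpace (IP E) p

/-- The left action of `g ∈ G` on the trivial principal bundle `P = G × 𝔤`. -/
def act (g : G) (p : G × E) : G × E := (g * p.1, p.2)

/-- The differential of the action of `g` at `p`. -/
def dAct (g : G) (p : G × E) : TP p →L[ℝ] TP (act g p) :=
  mfderiv (IP E) (IP E) (act g) p

/-- The fundamental vector field `ρ*` on `P`: the differential at `g = 1` of `g ↦ g · p`,
applied to `ρ ∈ 𝔤`. -/
def fund (ρ : E) (p : G × E) : TP p :=
  (mfderiv 𝓘(ℝ, E) (IP E) (fun g : G => act g p) 1 : E →L[ℝ] E × E) ρ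

/-- Smoothness of a `𝔤`-valued `1`-form on `P`: it is smooth as a function on `TP`. -/
def SmoothForm [LieGroup 𝓘(ℝ, E) ∞ G] (α : (p : G × E) → TP p →L[ℝ] E) : Prop :=
  ContMDiff (IP E).tangent 𝓘(ℝ, E) ∞ (fun v : TangentBundle (IP E) (G × E) => α v.1 v.2)

/-- A `1`-form on `P` with values in a vector space is non-degenerate if only vertical vectors
are in its kernel. -/
def Nondegenerate {W : Type*} [NormedAddCommGroup W] [NormedSpace ℝ W]
    (α : (p : G × E) → TP p →L[ℝ] W) : Prop :=
  ∀ (p : G × E) (X : TP p), α p X = 0 → ∃ ρ : E, X = fund ρ p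

/-- `θ` is a (smooth) connection `1`-form on the left principal `G`-bundle `P`. -/
structure IsConnectionForm [LieGroup 𝓘(ℝ, E) ∞ G] (θ : (p : G × E) → TP p →L[ℝ] E) : Prop where
  smooth : SmoothForm θ
  equivariant : ∀ (g : G) (p : G × E) (X : TP p), θ (act g p) (dAct g p X) = Ad g (θ p X)
  fund : ∀ (ρ : E) (p : G × E), θ p (fund ρ p) = ρ

/-- `L` is a (smooth) non-degenerate horizontal `ad G`-valued `1`-form on `P`. -/
structure IsNondegHorizontalForm [LieGroup 𝓘(ℝ, E) ∞ G] (L : (p : G × E) → TP p →L[ℝ] E) :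
    Prop where
  smooth : SmoothForm L
  equivariant : ∀ (g : G) (p : G × E) (X : TP p), L (act g p) (dAct g p X) = Ad g (L p X)
  horizontal : ∀ (ρ : E) (p : G × E), L p (KahlerGC.fund ρ p) = 0
  nondegenerate : Nondegenerate L

/-- The almost complex structure `I` on `P` defined by `(θ, L)`: `I X` is the unique vector with
`θ (I X) = -L X` and `L (I X) = θ X`. Thus `I ρ*` is the horizontal `Y` with `L Y = ρ`, and
`θ (ρ* + I σ*) = ρ`, `L (ρ* + I σ*) = σ`. -/
def cplx (θ L : (p : G × E) → TP p →L[ℝ] E) (p : G × E) : TP p →L[ℝ] TP p :=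
  ((θ p).prod (L p)).inverse.comp ((-(L p)).prod (θ p))

/-- `μ : P → 𝔤*` is (smooth and) `G`-equivariant. -/
structure IsSmoothEquivariant (μ : G × E → (E →L[ℝ] ℝ)) : Prop where
  smooth : ContMDiff (IP E) 𝓘(ℝ, E →L[ℝ] ℝ) ∞ μ
  equivariant : ∀ (g : G) (p : G × E), μ (act g p) = coAd g (μ p)

/-- The differential of `μ : P → 𝔤*`. -/
def dMap (μ : G × E → (E →L[ℝ] ℝ)) (p : G × E) : TP p →L[ℝ] (E →L[ℝ] ℝ) :=
  (mfderiv (IP E) 𝓘(ℝ, E →L[ℝ] ℝ) μ p : _)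

/-- The covariant derivative `Dμ = dμ + [μ, θ]`, where `⟨[μ, x], y⟩ = ⟨μ, [x, y]⟩`. -/
def covDeriv [LieGroup 𝓘(ℝ, E) ∞ G] (θ : (p : G × E) → TP p →L[ℝ] E) (μ : G × E → (E →L[ℝ] ℝ))
    (p : G × E) : TP p →L[ℝ] (E →L[ℝ] ℝ) :=
  dMap μ p + (ad G (μ p)).comp (θ p)

/-- The equivariant map `μ` is regular: its covariant derivative, which vanishes on vertical
vectors, is non-degenerate. -/
def IsRegular [LieGroup 𝓘(ℝ, E) ∞ G] (θ : (p : G × E) → TP p →L[ℝ] E)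
    (μ : G × E → (E →L[ℝ] ℝ)) : Prop :=
  Nondegenerate (covDeriv θ μ)

/-- Smooth Riemannian metrics on `P`. -/
abbrev Metric (E G : Type*) [NormedAddCommGroup E] [NormedSpace ℝ E]
    [TopologicalSpace G] [ChartedSpace E G] [Group G] [LieGroup 𝓘(ℝ, E) ∞ G] : Type _ :=
  Bundle.ContMDiffRiemannianMetric (IP E) ∞ (E × E) (fun p : G × E => TP p)

/-- `g` is a `G`-invariant Kähler metric, with Kähler form `κ = g(I ·, ·)`, for the complex
structure `I` on `P`. (Integrability of `I` is a property of `I` alone, see `IsIntegrable`.) -/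
structure IsInvariantKahler [LieGroup 𝓘(ℝ, E) ∞ G]
    (I : (p : G × E) → TP p →L[ℝ] TP p) (g : Metric E G)
    (κ : DiffForm (IP E) (M := G × E) 2) : Prop where
  invariant : ∀ (a : G) (p : G × E) (X Y : TP p),
    g.inner (act a p) (dAct a p X) (dAct a p Y) = g.inner p X Y
  hermitian : ∀ (p : G × E) (X Y : TP p), g.inner p (I p X) (I p Y) = g.inner p X Y
  kahlerForm : ∀ (p : G × E) (X Y : TP p), κ p ![X, Y] = g.inner p (I p X) Y
  closed : κ.d = 0

/-- The moment map condition `d⟨μ, ρ⟩ = κ(ρ*, ·)` for an equivariant `μ : P → 𝔤*`. -/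
def IsMomentMap (μ : G × E → (E →L[ℝ] ℝ)) (κ : DiffForm (IP E) (M := G × E) 2) : Prop :=
  ∀ (ρ : E) (p : G × E) (X : TP p), dMap μ p X ρ = κ p ![fund ρ p, X]

/-- The real-valued `1`-form `⟨μ, θ⟩` on `P`. -/
def pairing (μ : G × E → (E →L[ℝ] ℝ)) (θ : (p : G × E) → TP p →L[ℝ] E) :
    DiffForm (IP E) (M := G × E) 1 :=
  fun p => ContinuousAlternatingMap.ofSubsingleton ℝ (TP p) ℝ (0 : Fin 1) ((μ p).comp (θ p))

/-- The bilinear form `⟨x, Φ y⟩` on `𝔤*` given by `Φ : 𝔤* → 𝔤` is symmetric. -/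
def SymmForm (Φ : (E →L[ℝ] ℝ) →L[ℝ] E) : Prop := ∀ x y : E →L[ℝ] ℝ, x (Φ y) = y (Φ x)

/-- The bilinear form `⟨x, Φ y⟩` on `𝔤*` given by `Φ : 𝔤* → 𝔤` is positive on nonzero vectors. -/
def PosDefForm (Φ : (E →L[ℝ] ℝ) →L[ℝ] E) : Prop := ∀ x : E →L[ℝ] ℝ, x ≠ 0 → 0 < x (Φ x)

end KahlerGC

end

/-! Every tangent vector is uniquely X = ρ* + Iσ* with ρ = θ(X), σ = L(X). If g is Hermitian and μ
is a moment map for ω = g(I·,·), then g(Iρ*, Y) = ⟨dμ(Y), ρ⟩, hence also g(ρ*, Y) = ⟨dμ(IY), ρ⟩. So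
θ, L and μ leave only one candidate for g, namely `momentMetric`
(`IsComplexFraming.eq_momentMetric`), and the whole question is when this bilinear form is a Kähler
metric.

Regularity makes Dμ an isomorphism from horizontal vectors to 𝔤*, which gives Φ. Substituting dμ =
Φ⁻¹L − (ad μ)θ yields the explicit formula (`IsLegendre.momentMetric_eq`). The form is then
automatically I-invariant, and it is symmetric exactly when Φ is. Its quadratic form is Φ⁻¹(σ,σ) +
Φ⁻¹(ρ,ρ) + 2⟨μ,[σ,ρ]⟩. Completing the square in ρ leaves a Schur complement in σ, which for σ = Φ(x)
is the form Φ + Φ∘(ad μ∘Φ)² evaluated at x (`posDef_iff`).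

Closedness comes from integrability. Equivariance gives dθ(ρ*, ·) = [ρ, θ], and the Nijenhuis tensor
on fundamental fields gives dθ on pairs of horizontal vectors, so that dθ(X,Y) = [θX,θY] − [LX,LY]
(`IsComplexFraming.extDerivForm_θ`). The Leibniz rule then identifies −d⟨μ,θ⟩ with
`momentMetric`(I·,·) when Φ is symmetric (`IsLegendre.d_pairing`), so the Kähler form is exact.
Invariance of the metric follows from the equivariance of θ, L and μ.

The analytic input, obtained in charts, is that the derivative of Ad at the unit is the Lie bracket
(`exists_hasFDerivAt_Ad`), that one-forms and brackets can be differentiated in the preferred chart,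
and that d² = 0 on the manifold. -/

noncomputable section

namespace KahlerGC

/-! ### Calculus of invariant one-forms in a vector space -/

section Calculus

open Filter Topology

variable {S V W : Type*} [NormedAddCommGroup S] [NormedSpace ℝ S] [NormedAddCommGroup V]
  [NormedSpace ℝ V] [NormedAddCommGroup W] [NormedSpace ℝ W]

theorem hasFDerivAt_fderiv_of_contDiffAt {F : S → V} {a : S} (hF : ContDiffAt ℝ ∞ F a) :
    HasFDerivAt (fderiv ℝ F) (fderiv ℝ (fderiv ℝ F) a) a :=
  ((hF.fderiv_right (m := ∞) (by simp)).differentiableAt (by simp)).hasFDerivAt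

/-- Infinitesimal form of the equivariance of a one-form under a local action `F`. -/
theorem fderiv_oneForm_sub_of_equivariant {F : S × V → V} {e : S} {y₀ : V}
    (hF : ContDiffAt ℝ ∞ F (e, y₀)) (hFe : ∀ᶠ y in 𝓝 y₀, F (e, y) = y)
    {α : V → V →L[ℝ] W} (hα : DifferentiableAt ℝ α y₀)
    {A : S → W →L[ℝ] W} {A' : S →L[ℝ] W →L[ℝ] W} (hA : HasFDerivAt A A' e)
    (heq : ∀ᶠ s in 𝓝 e, ∀ w, α (F (s, y₀)) (fderiv ℝ F (s, y₀) (0, w)) = A s (α y₀ w))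
    (ρ : S) (c : W) (hc : ∀ᶠ y in 𝓝 y₀, α y (fderiv ℝ F (e, y) (ρ, 0)) = c) (w : V) :
    fderiv ℝ α y₀ (fderiv ℝ F (e, y₀) (ρ, 0)) w - fderiv ℝ α y₀ w (fderiv ℝ F (e, y₀) (ρ, 0)) =
      A' ρ (α y₀ w) := by
  have hFe₀ : F (e, y₀) = y₀ := hFe.self_of_nhds
  have hDF : HasFDerivAt F (fderiv ℝ F (e, y₀)) (e, y₀) :=
    (hF.differentiableAt (by simp)).hasFDerivAt
  have hDDF := hasFDerivAt_fderiv_of_contDiffAt hF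
  have hα' : HasFDerivAt α (fderiv ℝ α y₀) (F (e, y₀)) := by rw [hFe₀]; exact hα.hasFDerivAt
  have hsym := (hF.isSymmSndFDerivAt
    (by rw [minSmoothness_of_isRCLikeNormedField]; exact ENat.LEInfty.out)).eq
    (ρ, (0 : V)) ((0 : S), w)
  have h0w : fderiv ℝ F (e, y₀) (0, w) = w := by
    have h1 : HasFDerivAt (fun y => F (e, y))
        ((fderiv ℝ F (e, y₀)).comp (ContinuousLinearMap.inr ℝ S V)) y₀ :=
      hDF.comp y₀ (hasFDerivAt_prodMk_right e y₀)
    have h2 : HasFDerivAt (fun y => F (e, y)) (ContinuousLinearMap.id ℝ V) y₀ :=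
      (hasFDerivAt_id y₀).congr_of_eventuallyEq hFe
    simpa using DFunLike.congr_fun (h1.unique h2) w
  have g1 : HasFDerivAt (fun s => fderiv ℝ F (s, y₀)) _ e :=
    hDDF.comp e (hasFDerivAt_prodMk_left e y₀)
  have g2 : HasFDerivAt (fun s => α (F (s, y₀))) _ e :=
    hα'.comp e (hDF.comp e (hasFDerivAt_prodMk_left e y₀))
  have g3 : HasFDerivAt (fun y => fderiv ℝ F (e, y)) _ y₀ :=
    hDDF.comp y₀ (hasFDerivAt_prodMk_right e y₀)
  have e1 := g2.clm_apply (g1.clm_apply (hasFDerivAt_const ((0 : S), w) e))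
  have e2 : HasFDerivAt (fun s => A s (α y₀ w)) _ e :=
    hA.clm_apply (hasFDerivAt_const (α y₀ w) e)
  -- `e3` differentiates the equivariance identity along the group, `f2` differentiates the
  -- constancy of α on the orbit field along w. Each contains a mixed second derivative of F; the
  -- two agree by symmetry and cancel in the difference.
  have e3 := DFunLike.congr_fun (e1.unique (e2.congr_of_eventuallyEq
    (heq.mono fun s hs => hs w))) ρ
  have f1 := hα.hasFDerivAt.clm_apply (g3.clm_apply (hasFDerivAt_const (ρ, (0 : V)) y₀))
  have f2 := DFunLike.congr_fun (f1.unique ((hasFDerivAt_const c y₀).congr_of_eventuallyEq hc)) w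
  simp [hFe₀, h0w] at e3 f2
  rw [← e3, hsym, eq_neg_of_add_eq_zero_left f2]
  abel

/-- The derivative of the adjoint action, for a local group law `m` with unit `e`. -/
theorem hasFDerivAt_of_localGroupLaw [CompleteSpace S] {m : S × S → S} {e : S}
    (hm : ContDiffAt ℝ ∞ m (e, e)) (hme : ∀ᶠ s in 𝓝 e, m (s, e) = s)
    (hem : ∀ᶠ s in 𝓝 e, m (e, s) = s)
    {A : S → S →L[ℝ] S}
    (hA : ∀ᶠ s in 𝓝 e, ∀ v, fderiv ℝ m (e, s) (A s v, 0) = fderiv ℝ m (s, e) (0, v)) :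
    ∃ A' : S →L[ℝ] S →L[ℝ] S, HasFDerivAt A A' e ∧ ∀ ρ v, A' ρ v =
      fderiv ℝ (fderiv ℝ m) (e, e) (ρ, 0) (0, v) - fderiv ℝ (fderiv ℝ m) (e, e) (v, 0) (0, ρ) := by
  have hDm : HasFDerivAt m (fderiv ℝ m (e, e)) (e, e) :=
    (hm.differentiableAt (by simp)).hasFDerivAt
  have hDDm := hasFDerivAt_fderiv_of_contDiffAt hm
  have hsym := (hm.isSymmSndFDerivAt
    (by rw [minSmoothness_of_isRCLikeNormedField]; exact ENat.LEInfty.out))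
  set T : S → S →L[ℝ] S := fun s => (fderiv ℝ m (e, s)).comp (.inl ℝ S S) with hT
  set B : S → S →L[ℝ] S := fun s => (fderiv ℝ m (s, e)).comp (.inr ℝ S S) with hB
  have hTe : T e = .id ℝ S := by
    have h1 : HasFDerivAt (fun s => m (s, e)) (T e) e :=
      HasFDerivAt.comp (f := fun s => (s, e)) e hDm (hasFDerivAt_prodMk_left e e)
    exact h1.unique ((hasFDerivAt_id e).congr_of_eventuallyEq hme)
  have hBe : B e = .id ℝ S := by
    have h1 : HasFDerivAt (fun s => m (e, s)) (B e) e :=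
      hDm.comp e (hasFDerivAt_prodMk_right e e)
    exact h1.unique ((hasFDerivAt_id e).congr_of_eventuallyEq hem)
  have hT' : HasFDerivAt T _ e :=
    (show HasFDerivAt (fun s => fderiv ℝ m (e, s)) _ e from
      hDDm.comp e (hasFDerivAt_prodMk_right e e)).clm_comp (hasFDerivAt_const _ e)
  have hB' : HasFDerivAt B _ e :=
    (show HasFDerivAt (fun s => fderiv ℝ m (s, e)) _ e from
      HasFDerivAt.comp (f := fun s => (s, e)) e hDDm (hasFDerivAt_prodMk_left e e)).clm_comp (hasFDerivAt_const _ e)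
  have hinv : (T e).IsInvertible := ⟨.refl ℝ S, by rw [hTe]; rfl⟩
  have hinvs : ∀ᶠ s in 𝓝 e, (T s).IsInvertible := by
    obtain ⟨u, hu⟩ := hinv
    have := hT'.continuousAt.eventually (hu ▸ u.nhds)
    exact this
  -- No differentiability of A is assumed. It follows from A = T⁻¹B, where T s and B s are the
  -- derivatives of right and left translation by s at the unit.
  have hAeq : A =ᶠ[𝓝 e] fun s => (T s).inverse.comp (B s) := by
    filter_upwards [hA, hinvs] with s hs hi
    obtain ⟨u, hu⟩ := hi
    ext v
    have h := hs v
    have h' : T s (A s v) = B s v := by simpa [hT, hB] using h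
    rw [ContinuousLinearMap.comp_apply, ← h', ← hu]
    simp
  have hTd : DifferentiableAt ℝ (fun s => (T s).inverse) e :=
    (hinv.contDiffAt_map_inverse (n := 1)).differentiableAt (by simp) |>.comp e
      hT'.differentiableAt
  have hAd : HasFDerivAt A (fderiv ℝ A e) e :=
    ((hTd.clm_comp hB'.differentiableAt).congr_of_eventuallyEq hAeq).hasFDerivAt
  refine ⟨fderiv ℝ A e, hAd, fun ρ v => ?_⟩
  -- With differentiability known, the value of A' is read off from the product rule for TA = B at
  -- e, where T, A and B are all the identity.
  have hTA : (fun s => (T s).comp (A s)) =ᶠ[𝓝 e] B := by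
    filter_upwards [hA] with s hs
    ext v
    simpa [hT, hB] using hs v
  have hAe : A e = .id ℝ S := by
    have : (T e).comp (A e) = B e := hTA.self_of_nhds
    rwa [hTe, hBe, ContinuousLinearMap.id_comp] at this
  have h := DFunLike.congr_fun (DFunLike.congr_fun
    ((hT'.clm_comp hAd).unique (hB'.congr_of_eventuallyEq hTA)) ρ) v
  simp [hTe, hAe] at h
  rw [hsym.eq (v, 0) (0, ρ), ← h]
  abel

end Calculus

/-! ### One-forms and vector fields in a chart -/

section Chart

open Filter Topology

variable {V : Type*} [NormedAddCommGroup V] [NormedSpace ℝ V]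
  {W : Type*} [NormedAddCommGroup W] [NormedSpace ℝ W]
  {H : Type*} [TopologicalSpace H] (J : ModelWithCorners ℝ V H)
  {M : Type*} [TopologicalSpace M] [ChartedSpace H M]

/-- The derivative of the inverse of the preferred chart at `p₀`. -/
def chartFrame (p₀ : M) (y : V) : V →L[ℝ] V :=
  (mfderiv 𝓘(ℝ, V) J (extChartAt J p₀).symm y : _)

/-- The expression of a vector-valued one-form in the preferred chart at `p₀`. -/
def formInChart (α : M → V →L[ℝ] W) (p₀ : M) (y : V) : V →L[ℝ] W :=
  (α ((extChartAt J p₀).symm y)).comp (chartFrame J p₀ y)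

/-- The expression of a vector field in the preferred chart at `p₀`. -/
def fieldInChart (X : M → V) (p₀ : M) (y : V) : V :=
  (chartFrame J p₀ y).inverse (X ((extChartAt J p₀).symm y))

variable [IsManifold J ∞ M] [J.Boundaryless]

/-- The tangent space at p is the model space by way of the preferred chart at p, so that chart has
identity derivative there. This is why pointwise values at p need no transport when computing in the
chart at p. -/
theorem chartFrame_self (p : M) :
    chartFrame J p (extChartAt J p p) = ContinuousLinearMap.id ℝ V := by
  have : IsManifold J 1 M := IsManifold.of_le (n := ∞) (by simp)
  have h := mfderivWithin_range_extChartAt_symm (I := J) (x := p)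
  rw [J.range_eq_univ, mfderivWithin_univ] at h
  exact h

theorem isInvertible_chartFrame (p₀ : M) {y : V} (hy : y ∈ (extChartAt J p₀).target) :
    (chartFrame J p₀ y).IsInvertible := by
  have : IsManifold J 1 M := IsManifold.of_le (n := ∞) (by simp)
  have h := isInvertible_mfderivWithin_extChartAt_symm (I := J) hy
  rw [J.range_eq_univ, mfderivWithin_univ] at h
  exact h

theorem chartFrame_fieldInChart (X : M → V) (p₀ : M) {y : V} (hy : y ∈ (extChartAt J p₀).target) :
    chartFrame J p₀ y (fieldInChart J X p₀ y) = X ((extChartAt J p₀).symm y) := by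
  obtain ⟨e, he⟩ := isInvertible_chartFrame J p₀ hy
  simp [fieldInChart, ← he]

theorem mlieBracket_eq_lieBracket_fieldInChart (X Y : M → V) (p : M) :
    (VectorField.mlieBracket J (M := M) X Y p : V) =
      VectorField.lieBracket ℝ (fieldInChart J X p) (fieldInChart J Y p) (extChartAt J p p) := by
  have : IsManifold J 1 M := IsManifold.of_le (n := ∞) (by simp)
  have h := VectorField.mlieBracketWithin_apply (I := J) (V := X) (W := Y) (s := Set.univ) (x₀ := p)
  rw [mfderiv_extChartAt_self] at h
  simp only [J.range_eq_univ, Set.preimage_univ, Set.univ_inter] at h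
  refine h.trans ((DFunLike.congr_fun (ContinuousLinearMap.inverse_id (R := ℝ) (M := V)) _).trans ?_)
  have hZ (Z : (q : M) → TangentSpace J q) :
      VectorField.mpullbackWithin 𝓘(ℝ, V) J (extChartAt J p).symm Z Set.univ =
        fieldInChart J Z p :=
    VectorField.mpullbackWithin_univ.trans rfl
  exact (congrArg₂ (fun A B : V → V =>
    VectorField.lieBracketWithin ℝ A B Set.univ (extChartAt J p p)) (hZ X) (hZ Y)).trans
    (congrFun VectorField.lieBracketWithin_univ _)

/-- Smoothness of α as a function on the tangent bundle is tested along the tangent map of the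
inverse chart applied to each constant field v. In finite dimension this controls the
operator-valued function. -/
theorem contDiffOn_formInChart [FiniteDimensional ℝ V] {α : M → V →L[ℝ] W}
    (hα : ContMDiff J.tangent 𝓘(ℝ, W) ∞ (fun v : TangentBundle J M => α v.1 v.2)) (p₀ : M) :
    ContDiffOn ℝ ∞ (formInChart J α p₀) (extChartAt J p₀).target := by
  rw [contDiffOn_clm_apply]
  intro v
  have hU : IsOpen (extChartAt J p₀).target := isOpen_extChartAt_target p₀
  have h1 := (contMDiffOn_extChartAt_symm (I := J) (n := ∞) p₀).contMDiffOn_tangentMapWithin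
    (m := ∞) (by simp) hU.uniqueMDiffOn
  have h2 : ContMDiff 𝓘(ℝ, V) 𝓘(ℝ, V).tangent ∞
      (fun y : V => (⟨y, v⟩ : TangentBundle 𝓘(ℝ, V) V)) := by
    intro y
    rw [Bundle.contMDiffAt_totalSpace]
    refine ⟨contMDiffAt_id, ?_⟩
    simpa using contMDiffAt_const
  have h3 := (hα.comp_contMDiffOn h1).comp h2.contMDiffOn (s := (extChartAt J p₀).target)
    (fun y hy => hy)
  refine contMDiffOn_iff_contDiffOn.1 (h3.congr fun y hy => ?_)
  simp only [Function.comp, tangentMapWithin, mfderivWithin_of_isOpen hU hy]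
  rfl

end Chart
/-! ### Exterior derivatives in a chart -/

section ChartDeriv

open Filter Topology

variable {V : Type*} [NormedAddCommGroup V] [NormedSpace ℝ V]
  {W : Type*} [NormedAddCommGroup W] [NormedSpace ℝ W]
  {H : Type*} [TopologicalSpace H] (J : ModelWithCorners ℝ V H)
  {M : Type*} [TopologicalSpace M] [ChartedSpace H M]

/-- The exterior derivative of a vector-valued one-form, computed in the preferred chart. -/
def extDerivForm (α : M → V →L[ℝ] W) (p : M) (X Y : V) : W :=
  fderiv ℝ (formInChart J α p) (extChartAt J p p) X Y -
    fderiv ℝ (formInChart J α p) (extChartAt J p p) Y X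

theorem extDerivForm_swap (α : M → V →L[ℝ] W) (p : M) (X Y : V) :
    extDerivForm J α p X Y = -extDerivForm J α p Y X := by
  simp [extDerivForm]

theorem extDerivForm_add_left (α : M → V →L[ℝ] W) (p : M) (X X' Y : V) :
    extDerivForm J α p (X + X') Y = extDerivForm J α p X Y + extDerivForm J α p X' Y := by
  simp only [extDerivForm, map_add, add_apply]
  abel

theorem extDerivForm_add_right (α : M → V →L[ℝ] W) (p : M) (X Y Y' : V) :
    extDerivForm J α p X (Y + Y') = extDerivForm J α p X Y + extDerivForm J α p X Y' := by
  simp only [extDerivForm, map_add, add_apply]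
  abel

theorem d_neg {n : ℕ} (α : DiffForm J (M := M) n) : (-α).d = -α.d := by
  funext p
  have h : (-α).inChart p = (-1 : ℝ) • α.inChart p := by
    funext y
    ext v
    change -(α.inChart p y v) = (-1 : ℝ) • (α.inChart p y v)
    simp
  have := extDeriv_smul (-1 : ℝ) (α.inChart p) (x := extChartAt J p p)
  rw [← h, neg_one_smul] at this
  exact this

variable [J.Boundaryless]

theorem extChartAt_target_mem_nhds_self (p : M) :
    (extChartAt J p).target ∈ 𝓝 (extChartAt J p p) :=
  (isOpen_extChartAt_target p).mem_nhds (mem_extChartAt_target p)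

variable [IsManifold J ∞ M]

theorem formInChart_self (α : M → V →L[ℝ] W) (p : M) :
    formInChart J α p (extChartAt J p p) = α p := by
  rw [formInChart, chartFrame_self, extChartAt_to_inv, ContinuousLinearMap.comp_id]

theorem fieldInChart_self (X : M → V) (p : M) :
    fieldInChart J X p (extChartAt J p p) = X p := by
  rw [fieldInChart, chartFrame_self, extChartAt_to_inv, ContinuousLinearMap.inverse_id,
    ContinuousLinearMap.id_apply]

/-- For vector fields on which a one-form is constant, its exterior derivative is given by the
Lie bracket. -/
theorem extDerivForm_eq_neg_mlieBracket {α : M → V →L[ℝ] W} {X Y : M → V} {p : M}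
    (hα : DifferentiableAt ℝ (formInChart J α p) (extChartAt J p p))
    (hX : DifferentiableAt ℝ (fieldInChart J X p) (extChartAt J p p))
    (hY : DifferentiableAt ℝ (fieldInChart J Y p) (extChartAt J p p))
    {a b : W} (ha : ∀ q, α q (X q) = a) (hb : ∀ q, α q (Y q) = b) :
    extDerivForm J α p (X p) (Y p) = -α p (VectorField.mlieBracket J (M := M) X Y p : V) := by
  -- Differentiating α(Z) = c trades the derivative of α for a derivative of Z; the
  -- antisymmetrization is then the bracket.
  have key (Z : M → V) (hZ : DifferentiableAt ℝ (fieldInChart J Z p) (extChartAt J p p)) (c : W)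
      (hc : ∀ q, α q (Z q) = c) (w : V) : fderiv ℝ (formInChart J α p) (extChartAt J p p) w (Z p) =
        -α p (fderiv ℝ (fieldInChart J Z p) (extChartAt J p p) w) := by
    have h1 := hα.hasFDerivAt.clm_apply hZ.hasFDerivAt
    have h2 : (fun y => formInChart J α p y (fieldInChart J Z p y)) =ᶠ[𝓝 (extChartAt J p p)]
        fun _ => c := by
      filter_upwards [extChartAt_target_mem_nhds_self J p] with y hy
      rw [formInChart, ContinuousLinearMap.comp_apply, chartFrame_fieldInChart J Z p hy, hc]
    have h3 := DFunLike.congr_fun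
      (h1.unique ((hasFDerivAt_const c _).congr_of_eventuallyEq h2)) w
    simp only [formInChart_self, fieldInChart_self, add_apply,
      ContinuousLinearMap.comp_apply, ContinuousLinearMap.flip_apply,
      zero_apply] at h3
    rw [← add_eq_zero_iff_eq_neg, add_comm, h3]
  rw [extDerivForm, key Y hY b hb, key X hX a ha, mlieBracket_eq_lieBracket_fieldInChart,
    VectorField.lieBracket, fieldInChart_self, fieldInChart_self, map_sub]
  abel

theorem contMDiffAt_extChartAt_symm_of_mem (p : M) {y : V} (hy : y ∈ (extChartAt J p).target) :
    ContMDiffAt 𝓘(ℝ, V) J ∞ (extChartAt J p).symm y :=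
  (contMDiffOn_extChartAt_symm (I := J) (n := ∞) p).contMDiffAt
    ((isOpen_extChartAt_target p).mem_nhds hy)

theorem hasMFDerivAt_chartFrame (p : M) {y : V} (hy : y ∈ (extChartAt J p).target) :
    HasMFDerivAt 𝓘(ℝ, V) J (extChartAt J p).symm y (chartFrame (V := V) J p y) :=
  ((contMDiffAt_extChartAt_symm_of_mem J p hy).mdifferentiableAt (by simp)).hasMFDerivAt

/-- The chain rule for a curve or map lifted to a chart. -/
theorem chartFrame_comp_eq {U : Type*} [NormedAddCommGroup U] [NormedSpace ℝ U] (p : M)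
    {f : U → V} {f' : U →L[ℝ] V} {z : U} (hf : HasFDerivAt f f' z)
    (hz : f z ∈ (extChartAt J p).target) {h : U → M} {h' : U →L[ℝ] V}
    (hh : HasMFDerivAt 𝓘(ℝ, U) J h z h')
    (heq : (fun u => (extChartAt J p).symm (f u)) =ᶠ[𝓝 z] h) :
    (chartFrame J p (f z)).comp f' = h' :=
  hasMFDerivAt_unique (((hasMFDerivAt_chartFrame J p hz).comp z hf.hasMFDerivAt)) 
    (hh.congr_of_eventuallyEq heq)

/-- In any preferred chart, the exterior derivative on the manifold is the exterior derivative on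
the model space. -/
theorem inChart_d_eq_extDeriv {n : ℕ} {α : DiffForm J (M := M) n}
    (hα : ∀ p, ContDiffOn ℝ ∞ (α.inChart p) (extChartAt J p).target) (p₀ : M) {y : V}
    (hy : y ∈ (extChartAt J p₀).target) :
    α.d.inChart p₀ y = extDeriv (α.inChart p₀) y := by
  have : IsManifold J 1 M := IsManifold.of_le (n := ∞) (by simp)
  set q : M := (extChartAt J p₀).symm y with hq
  set f : V → V := fun z => extChartAt J q ((extChartAt J p₀).symm z) with hf
  have hcont : ContinuousAt (extChartAt J p₀).symm y := (hasMFDerivAt_chartFrame J p₀ hy).continuousAt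
  have hfsmooth : ContDiffAt ℝ ∞ f y := by
    rw [← contMDiffAt_iff_contDiffAt]
    exact (contMDiffAt_extChartAt (I := J) (n := ∞) (x := q)).comp y
      ((contMDiffOn_extChartAt_symm (I := J) (n := ∞) p₀).contMDiffAt
        ((isOpen_extChartAt_target p₀).mem_nhds hy))
  have hnhds : ∀ᶠ z in 𝓝 y, z ∈ (extChartAt J p₀).target ∧
      (extChartAt J p₀).symm z ∈ (extChartAt J q).source :=
    (eventually_mem_nhds_iff.2 ((isOpen_extChartAt_target p₀).mem_nhds hy)).mono
      (fun z hz => mem_of_mem_nhds hz) |>.and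
      (hcont.eventually (extChartAt_source_mem_nhds (I := J) q))
  have hdf : ∀ᶠ z in 𝓝 y, DifferentiableAt ℝ f z := by
    have := (hfsmooth.of_le (m := 1) (by simp)).eventually (by simp)
    exact this.mono fun z hz => hz.differentiableAt (by simp)
  have hfy : f y = extChartAt J q q := rfl
  have hframe (z : V) (hz : z ∈ (extChartAt J p₀).target)
      (hz' : (extChartAt J p₀).symm z ∈ (extChartAt J q).source) (hd : DifferentiableAt ℝ f z) :
      (chartFrame J q (f z)).comp (fderiv ℝ f z) = chartFrame J p₀ z := by
    refine chartFrame_comp_eq J q hd.hasFDerivAt ((extChartAt J q).map_source hz')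
      (hasMFDerivAt_chartFrame J p₀ hz) ?_
    filter_upwards [(hasMFDerivAt_chartFrame J p₀ hz).continuousAt.eventually
      ((isOpen_extChartAt_source q).mem_nhds hz')] with w hw
    exact (extChartAt J q).left_inv hw
  -- At q the derivative is defined through the chart at q. In the chart at p₀ the form is the
  -- pull-back under the transition map f, and the exterior derivative commutes with pull-backs.
  have hpull : α.inChart p₀ =ᶠ[𝓝 y]
      fun z => (α.inChart q (f z)).compContinuousLinearMap (fderiv ℝ f z) := by
    filter_upwards [hnhds, hdf] with z hz hd
    have h1 := hframe z hz.1 hz.2 hd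
    have h2 : (extChartAt J q).symm (f z) = (extChartAt J p₀).symm z :=
      (extChartAt J q).left_inv hz.2
    let β : M → V [⋀^Fin n]→L[ℝ] ℝ := α
    have h4 : α.inChart p₀ z = (β ((extChartAt J p₀).symm z)).compContinuousLinearMap
        (chartFrame J p₀ z) := rfl
    have h5 : α.inChart q (f z) = (β ((extChartAt J q).symm (f z))).compContinuousLinearMap
        (chartFrame J q (f z)) := rfl
    rw [h4, h5, ← h1, h2]
    rfl
  rw [hpull.extDeriv_eq, extDeriv_pullback (r := ∞) _ hfsmooth
    (by rw [minSmoothness_of_isRCLikeNormedField]; exact ENat.LEInfty.out)]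
  · have h := hframe y hy (mem_extChartAt_source q) hdf.self_of_nhds
    rw [hfy, chartFrame_self, ContinuousLinearMap.id_comp] at h
    rw [h]
    rfl
  · rw [hfy]
    exact ((hα q).contDiffAt (extChartAt_target_mem_nhds_self J q)).differentiableAt (by simp)

/-- The definition of `DiffForm.d` changes chart from point to point. By independence of the chart,
the single chart at p computes the inner derivative on a whole neighbourhood, and d² = 0 in the
model space applies. -/
theorem d_d_eq_zero {n : ℕ} {α : DiffForm J (M := M) n}
    (hα : ∀ p, ContDiffOn ℝ ∞ (α.inChart p) (extChartAt J p).target) : α.d.d = 0 := by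
  funext p
  have h : α.d.inChart p =ᶠ[𝓝 (extChartAt J p p)] extDeriv (α.inChart p) := by
    filter_upwards [extChartAt_target_mem_nhds_self J p] with y hy
    exact inChart_d_eq_extDeriv J hα p hy
  exact h.extDeriv_eq.trans (extDeriv_extDeriv_apply (r := ∞)
    ((hα p).contDiffAt (extChartAt_target_mem_nhds_self J p))
    (by rw [minSmoothness_of_isRCLikeNormedField]; exact ENat.LEInfty.out))

end ChartDeriv

/-! ### Local actions in charts -/

section Action

open Filter Topology

variable {S : Type*} [NormedAddCommGroup S] [NormedSpace ℝ S]
  {K : Type*} [TopologicalSpace K] (J' : ModelWithCorners ℝ S K)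
  {N : Type*} [TopologicalSpace N] [ChartedSpace K N]
  {V : Type*} [NormedAddCommGroup V] [NormedSpace ℝ V]
  {H : Type*} [TopologicalSpace H] (J : ModelWithCorners ℝ V H)
  {M : Type*} [TopologicalSpace M] [ChartedSpace H M]

variable {J' J} in
/-- The derivative of a map between manifolds, as a linear map between the model spaces. -/
def derivMap (f : N → M) (q : N) : S →L[ℝ] V := (mfderiv J' J f q : _)

/-- A map `N × M → M` in the preferred charts at `x` and `p`. -/
def actInChart (a : N → M → M) (x : N) (p : M) (z : S × V) : V :=
  extChartAt J p (a ((extChartAt J' x).symm z.1) ((extChartAt J p).symm z.2))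

/-- The set on which the expression of a map `N × M → M` in charts is meaningful. -/
def actDomain (a : N → M → M) (x : N) (p : M) : Set (S × V) :=
  {z | (z.1 ∈ (extChartAt J' x).target ∧ z.2 ∈ (extChartAt J p).target) ∧
    a ((extChartAt J' x).symm z.1) ((extChartAt J p).symm z.2) ∈ (extChartAt J p).source}

variable {J' J} in
theorem derivMap_comp {U : Type*} [NormedAddCommGroup U] [NormedSpace ℝ U]
    {K' : Type*} [TopologicalSpace K'] {J'' : ModelWithCorners ℝ U K'}
    {Q : Type*} [TopologicalSpace Q] [ChartedSpace K' Q] {f : N → M} {h : M → Q} {q : N}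
    (hh : MDifferentiableAt J J'' h (f q)) (hf : MDifferentiableAt J' J f q) :
    derivMap (J' := J') (J := J'') (fun x => h (f x)) q =
      (derivMap (J' := J) (J := J'') h (f q)).comp (derivMap (J' := J') (J := J) f q) :=
  mfderiv_comp q hh hf

theorem derivMap_id (q : M) :
    derivMap (J' := J) (J := J) (fun x : M => x) q = ContinuousLinearMap.id ℝ V :=
  mfderiv_id

variable {a : N → M → M}

theorem actInChart_of_fixed {x : N} (hx : ∀ q : M, a x q = q) {p : M} {y : V}
    (hy : y ∈ (extChartAt J p).target) :
    actInChart J' J a x p (extChartAt J' x x, y) = y := by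
  simp only [actInChart, extChartAt_to_inv, hx]
  exact (extChartAt J p).right_inv hy

theorem mem_actDomain {x : N} {p : M} (hx : a x p = p) :
    (extChartAt J' x x, extChartAt J p p) ∈ actDomain J' J a x p := by
  refine ⟨⟨mem_extChartAt_target x, mem_extChartAt_target p⟩, ?_⟩
  simp only [extChartAt_to_inv, hx]
  exact mem_extChartAt_source p

variable [IsManifold J' ∞ N] [J'.Boundaryless] [IsManifold J ∞ M] [J.Boundaryless]

theorem contMDiffAt_act_of_mem (ha : ContMDiff (J'.prod J) J ∞ (fun z : N × M => a z.1 z.2))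
    {x : N} {p : M} {z : S × V} (hz : z ∈ actDomain J' J a x p) :
    ContMDiffAt 𝓘(ℝ, S × V) J ∞
      (fun z : S × V => a ((extChartAt J' x).symm z.1) ((extChartAt J p).symm z.2)) z := by
  have h1 := (contMDiffAt_extChartAt_symm_of_mem J' x hz.1.1).comp z
    (contDiffAt_fst (𝕜 := ℝ) (n := ∞)).contMDiffAt
  have h2 := (contMDiffAt_extChartAt_symm_of_mem J p hz.1.2).comp z
    (contDiffAt_snd (𝕜 := ℝ) (n := ∞)).contMDiffAt
  exact (ha _).comp z (h1.prodMk h2)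

theorem contDiffAt_actInChart (ha : ContMDiff (J'.prod J) J ∞ (fun z : N × M => a z.1 z.2))
    {x : N} {p : M} {z : S × V} (hz : z ∈ actDomain J' J a x p) :
    ContDiffAt ℝ ∞ (actInChart J' J a x p) z := by
  rw [← contMDiffAt_iff_contDiffAt]
  have h := (contMDiffOn_extChartAt (I := J) (n := ∞) (x := p)).contMDiffAt
    ((chartAt H p).open_source.mem_nhds (by simpa [extChartAt_source] using hz.2))
  exact h.comp z (contMDiffAt_act_of_mem J' J ha hz)

theorem actDomain_mem_nhds (ha : ContMDiff (J'.prod J) J ∞ (fun z : N × M => a z.1 z.2))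
    {x : N} {p : M} {z : S × V} (hz : z ∈ actDomain J' J a x p) :
    actDomain J' J a x p ∈ 𝓝 z := by
  have h1 := (isOpen_extChartAt_target (I := J') x).mem_nhds hz.1.1
  have h2 := (isOpen_extChartAt_target (I := J) p).mem_nhds hz.1.2
  have h3 := (contMDiffAt_act_of_mem J' J ha hz).continuousAt.eventually
    ((isOpen_extChartAt_source p).mem_nhds hz.2)
  filter_upwards [continuousAt_fst.eventually h1, continuousAt_snd.eventually h2, h3]
    with w hw1 hw2 hw3
  exact ⟨⟨hw1, hw2⟩, hw3⟩

/-- The partial derivative of an action in charts with respect to the second variable. -/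
theorem chartFrame_fderiv_actInChart_inr
    (ha : ContMDiff (J'.prod J) J ∞ (fun z : N × M => a z.1 z.2))
    {x : N} {p : M} {z : S × V} (hz : z ∈ actDomain J' J a x p) (w : V) :
    chartFrame J p (actInChart J' J a x p z) (fderiv ℝ (actInChart J' J a x p) z (0, w)) =
      derivMap (J' := J) (J := J) (a ((extChartAt J' x).symm z.1)) ((extChartAt J p).symm z.2)
        (chartFrame J p z.2 w) := by
  obtain ⟨s, y⟩ := z
  have h1 : HasFDerivAt (fun y => actInChart J' J a x p (s, y))
      ((fderiv ℝ (actInChart J' J a x p) (s, y)).comp (.inr ℝ S V)) y :=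
    HasFDerivAt.comp (f := fun y => (s, y)) y
      ((contDiffAt_actInChart J' J ha hz).differentiableAt (by simp)).hasFDerivAt
      (hasFDerivAt_prodMk_right s y)
  have h2 : ContMDiff J J ∞ (a ((extChartAt J' x).symm s)) :=
    ha.comp (contMDiff_const.prodMk contMDiff_id)
  have h3 := ((h2.mdifferentiable (by simp)) ((extChartAt J p).symm y)).hasMFDerivAt.comp y
    (hasMFDerivAt_chartFrame J p hz.1.2)
  have h4 := chartFrame_comp_eq J p h1 ((extChartAt J p).map_source hz.2) h3 (by
    filter_upwards [(Continuous.prodMk_right s).continuousAt.eventually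
      (actDomain_mem_nhds J' J ha hz)] with u hu
    exact (extChartAt J p).left_inv hu.2)
  exact DFunLike.congr_fun h4 w

/-- The partial derivative of an action in charts with respect to the first variable. -/
theorem chartFrame_fderiv_actInChart_inl
    (ha : ContMDiff (J'.prod J) J ∞ (fun z : N × M => a z.1 z.2))
    {x : N} {p : M} {z : S × V} (hz : z ∈ actDomain J' J a x p) (ρ : S) :
    chartFrame J p (actInChart J' J a x p z) (fderiv ℝ (actInChart J' J a x p) z (ρ, 0)) =
      derivMap (J' := J') (J := J) (fun g => a g ((extChartAt J p).symm z.2))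
        ((extChartAt J' x).symm z.1) (chartFrame J' x z.1 ρ) := by
  obtain ⟨s, y⟩ := z
  have h1 : HasFDerivAt (fun s => actInChart J' J a x p (s, y))
      ((fderiv ℝ (actInChart J' J a x p) (s, y)).comp (.inl ℝ S V)) s :=
    HasFDerivAt.comp (f := fun s => (s, y)) s
      ((contDiffAt_actInChart J' J ha hz).differentiableAt (by simp)).hasFDerivAt
      (hasFDerivAt_prodMk_left s y)
  have h2 : ContMDiff J' J ∞ (fun g => a g ((extChartAt J p).symm y)) :=
    ha.comp (contMDiff_id.prodMk contMDiff_const)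
  have h3 := ((h2.mdifferentiable (by simp)) ((extChartAt J' x).symm s)).hasMFDerivAt.comp s
    (hasMFDerivAt_chartFrame J' x hz.1.1)
  have h4 := chartFrame_comp_eq J p h1 ((extChartAt J p).map_source hz.2) h3 (by
    filter_upwards [(Continuous.prodMk_left y).continuousAt.eventually
      (actDomain_mem_nhds J' J ha hz)] with u hu
    exact (extChartAt J p).left_inv hu.2)
  exact DFunLike.congr_fun h4 ρ

end Action
/-! ### The adjoint action and its derivative -/

section LieGroup

open Filter Topology

variable {E : Type*} [NormedAddCommGroup E] [NormedSpace ℝ E]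
  {G : Type*} [TopologicalSpace G] [ChartedSpace E G] [Group G] [LieGroup 𝓘(ℝ, E) ∞ G]

/-- The multiplication of `G` as an action of `G` on itself. -/
def mulMap (G : Type*) [Group G] (g h : G) : G := g * h

/-- The left-invariant vector field with value `v` at the unit. -/
def leftField (v : E) (g : G) : E :=
  derivMap (J' := 𝓘(ℝ, E)) (J := 𝓘(ℝ, E)) (mulMap G g) 1 v

/-- The chart expression of the multiplication of `G` near the unit. -/
abbrev mulInChart (E G : Type*) [NormedAddCommGroup E] [NormedSpace ℝ E] [TopologicalSpace G]
    [ChartedSpace E G] [Group G] : E × E → E :=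
  actInChart 𝓘(ℝ, E) 𝓘(ℝ, E) (mulMap G) 1 1

theorem contMDiff_mul_uncurried : ContMDiff (𝓘(ℝ, E).prod 𝓘(ℝ, E)) 𝓘(ℝ, E) ∞
    (fun z : G × G => mulMap G z.1 z.2) := contMDiff_mul 𝓘(ℝ, E) ∞

theorem mdifferentiable_conj (g : G) :
    MDifferentiable 𝓘(ℝ, E) 𝓘(ℝ, E) (fun h : G => g * h * g⁻¹) :=
  (((contMDiff_mul_right (a := g⁻¹)).comp (contMDiff_mul_left (a := g)) :
    ContMDiff 𝓘(ℝ, E) 𝓘(ℝ, E) ∞ _)).mdifferentiable (by simp)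

/-- Differentiate (g h g⁻¹) g = g h at h = 1. This form of the adjoint action avoids inversion and
so can be expressed through the multiplication alone. -/
theorem derivMap_mul_right_Ad (g : G) (v : E) :
    derivMap (J' := 𝓘(ℝ, E)) (J := 𝓘(ℝ, E)) (fun h : G => h * g) 1 (Ad g v) =
      derivMap (J' := 𝓘(ℝ, E)) (J := 𝓘(ℝ, E)) (fun h : G => g * h) 1 v := by
  have h1 : ContMDiff 𝓘(ℝ, E) 𝓘(ℝ, E) ∞ (fun h : G => h * g) := contMDiff_mul_right
  have h3 := derivMap_comp (q := (1 : G)) ((h1.mdifferentiable (by simp)) _)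
    (mdifferentiable_conj (E := E) g 1)
  simp only [inv_mul_cancel_right, mul_one, mul_inv_cancel] at h3
  exact (DFunLike.congr_fun h3 v).symm

theorem Ad_inv_Ad (g : G) (v : E) : Ad g⁻¹ (Ad g v) = v := by
  have h3 := derivMap_comp (q := (1 : G)) (mdifferentiable_conj (E := E) g⁻¹ _)
    (mdifferentiable_conj (E := E) g 1)
  have hfun : (fun h : G => g⁻¹ * (g * h * g⁻¹) * g⁻¹⁻¹) = fun h => h := by
    funext h
    simp [mul_assoc]
  rw [hfun, derivMap_id, mul_one, mul_inv_cancel] at h3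
  exact (DFunLike.congr_fun h3 v).symm

variable (G) in
/-- The Lie bracket in terms of the second derivative of the multiplication. -/
theorem lieBr_eq_fderiv_fderiv (v w : E) :
    lieBr G v w =
      fderiv ℝ (fderiv ℝ (mulInChart E G)) (extChartAt 𝓘(ℝ, E) (1 : G) 1, extChartAt 𝓘(ℝ, E) (1 : G) 1) (v, 0) (0, w) -
      fderiv ℝ (fderiv ℝ (mulInChart E G)) (extChartAt 𝓘(ℝ, E) (1 : G) 1, extChartAt 𝓘(ℝ, E) (1 : G) 1) (w, 0) (0, v) := by
  set e : E := extChartAt 𝓘(ℝ, E) (1 : G) 1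
  have hdom : (e, e) ∈ actDomain 𝓘(ℝ, E) 𝓘(ℝ, E) (mulMap G) 1 1 :=
    mem_actDomain _ _ (one_mul 1)
  have hm := contDiffAt_actInChart _ _ (contMDiff_mul_uncurried (E := E) (G := G)) hdom
  -- In the chart, a left-invariant field is a partial derivative of the multiplication, so the
  -- bracket of two of them is a difference of mixed second derivatives.
  have hfield (v : E) : fieldInChart 𝓘(ℝ, E) (leftField (G := G) v) 1 =ᶠ[𝓝 e]
      fun s => fderiv ℝ (mulInChart E G) (s, e) (0, v) := by
    filter_upwards [(Continuous.prodMk_left e).continuousAt.eventually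
      (actDomain_mem_nhds _ _ (contMDiff_mul_uncurried (E := E) (G := G)) hdom)] with s hs
    replace hs : (s, e) ∈ actDomain 𝓘(ℝ, E) 𝓘(ℝ, E) (mulMap G) 1 1 := hs
    obtain ⟨u, hu⟩ := isInvertible_chartFrame 𝓘(ℝ, E) (1 : G) hs.1.1
    have h := chartFrame_fderiv_actInChart_inr _ _ (contMDiff_mul_uncurried (E := E) (G := G)) hs v
    have hse : actInChart 𝓘(ℝ, E) 𝓘(ℝ, E) (mulMap G) 1 1 (s, e) = s := by
      simp only [actInChart, e, extChartAt_to_inv, mulMap, mul_one]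
      exact (extChartAt 𝓘(ℝ, E) (1 : G)).right_inv hs.1.1
    rw [hse, chartFrame_self, extChartAt_to_inv, ContinuousLinearMap.id_apply] at h
    rw [fieldInChart, leftField, ← h, ← hu]
    simp
  have hd (v : E) : HasFDerivAt (fun s => fderiv ℝ (mulInChart E G) (s, e) (0, v)) _ e :=
    (HasFDerivAt.comp (f := fun s => (s, e)) e (hasFDerivAt_fderiv_of_contDiffAt hm)
      (hasFDerivAt_prodMk_left e e)).clm_apply (hasFDerivAt_const ((0 : E), v) e)
  have hself (v : E) : fieldInChart 𝓘(ℝ, E) (leftField (G := G) v) 1 e = v := by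
    refine (fieldInChart_self 𝓘(ℝ, E) (leftField (G := G) v) 1).trans ?_
    have hfun : mulMap G 1 = fun h => h := by funext h; simp [mulMap]
    rw [leftField, hfun, derivMap_id, ContinuousLinearMap.id_apply]
  refine (mlieBracket_eq_lieBracket_fieldInChart 𝓘(ℝ, E) _ _ (1 : G)).trans ?_
  change VectorField.lieBracket ℝ (fieldInChart 𝓘(ℝ, E) (leftField (G := G) v) 1)
    (fieldInChart 𝓘(ℝ, E) (leftField (G := G) w) 1) e = _
  rw [VectorField.lieBracket, hself v, hself w, ((hd w).congr_of_eventuallyEq (hfield w)).fderiv,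
    ((hd v).congr_of_eventuallyEq (hfield v)).fderiv]
  simp

variable (G) in
/-- The derivative at the unit of the adjoint action is the Lie bracket. -/
theorem exists_hasFDerivAt_Ad [FiniteDimensional ℝ E] :
    ∃ A' : E →L[ℝ] E →L[ℝ] E,
      HasFDerivAt (fun s : E => (Ad ((extChartAt 𝓘(ℝ, E) (1 : G)).symm s) : E →L[ℝ] E)) A'
        (extChartAt 𝓘(ℝ, E) (1 : G) 1) ∧ ∀ ρ v, A' ρ v = lieBr G ρ v := by
  have : CompleteSpace E := FiniteDimensional.complete ℝ E
  set e : E := extChartAt 𝓘(ℝ, E) (1 : G) 1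
  have hmul := contMDiff_mul_uncurried (E := E) (G := G)
  have hdom : (e, e) ∈ actDomain 𝓘(ℝ, E) 𝓘(ℝ, E) (mulMap G) 1 1 :=
    mem_actDomain _ _ (one_mul 1)
  have hm := contDiffAt_actInChart _ _ hmul hdom
  have hme (s : E) (hs : s ∈ (extChartAt 𝓘(ℝ, E) (1 : G)).target) : mulInChart E G (s, e) = s := by
    simp only [mulInChart, actInChart, e, extChartAt_to_inv, mulMap, mul_one]
    exact (extChartAt 𝓘(ℝ, E) (1 : G)).right_inv hs
  have hem (s : E) (hs : s ∈ (extChartAt 𝓘(ℝ, E) (1 : G)).target) : mulInChart E G (e, s) = s :=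
    actInChart_of_fixed _ _ (fun q => one_mul q) hs
  have htgt := extChartAt_target_mem_nhds_self 𝓘(ℝ, E) (1 : G)
  obtain ⟨A', hA', h⟩ := hasFDerivAt_of_localGroupLaw (m := mulInChart E G) (e := e)
    (A := fun s : E => (Ad ((extChartAt 𝓘(ℝ, E) (1 : G)).symm s) : E →L[ℝ] E)) hm
    (eventually_of_mem htgt hme) (eventually_of_mem htgt hem) (by
      filter_upwards [(Continuous.prodMk_left e).continuousAt.eventually
          (actDomain_mem_nhds _ _ hmul hdom),
        (Continuous.prodMk_right e).continuousAt.eventually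
          (actDomain_mem_nhds _ _ hmul hdom)] with s hs hs' v
      replace hs : (s, e) ∈ actDomain 𝓘(ℝ, E) 𝓘(ℝ, E) (mulMap G) 1 1 := hs
      replace hs' : (e, s) ∈ actDomain 𝓘(ℝ, E) 𝓘(ℝ, E) (mulMap G) 1 1 := hs'
      obtain ⟨u, hu⟩ := isInvertible_chartFrame 𝓘(ℝ, E) (1 : G) hs.1.1
      have h1 := chartFrame_fderiv_actInChart_inr _ _ hmul hs v
      have h2 := chartFrame_fderiv_actInChart_inl _ _ hmul hs'
        (Ad ((extChartAt 𝓘(ℝ, E) (1 : G)).symm s) v)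
      change chartFrame 𝓘(ℝ, E) (1 : G) (mulInChart E G (s, e)) _ = _ at h1
      change chartFrame 𝓘(ℝ, E) (1 : G) (mulInChart E G (e, s)) _ = _ at h2
      rw [hme s hs.1.1, chartFrame_self, extChartAt_to_inv, ContinuousLinearMap.id_apply] at h1
      rw [hem s hs.1.1, chartFrame_self, extChartAt_to_inv, ContinuousLinearMap.id_apply] at h2
      apply u.injective
      have h3 := (h2.trans (derivMap_mul_right_Ad _ v)).trans h1.symm
      rw [← hu] at h3
      exact h3)
  exact ⟨A', hA', fun ρ v => (h ρ v).trans (lieBr_eq_fderiv_fderiv G ρ v).symm⟩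

end LieGroup
-- Smooth vector fields seen in charts
section SmoothField

open Filter Topology

variable {V : Type*} [NormedAddCommGroup V] [NormedSpace ℝ V]
  {H : Type*} [TopologicalSpace H] (J : ModelWithCorners ℝ V H)
  {M : Type*} [TopologicalSpace M] [ChartedSpace H M] [IsManifold J ∞ M] [J.Boundaryless]

theorem inverse_chartFrame_extChartAt (p : M) {q : M} (hq : q ∈ (extChartAt J p).source) :
    (chartFrame J p (extChartAt J p q)).inverse =
      derivMap (J' := J) (J := 𝓘(ℝ, V)) (extChartAt J p) q := by
  have : IsManifold J 1 M := IsManifold.of_le (n := ∞) (by simp)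
  have h1 := mfderivWithin_extChartAt_symm_comp_mfderiv_extChartAt' (I := J) hq
  have h2 := mfderiv_extChartAt_comp_mfderivWithin_extChartAt_symm' (I := J) hq
  rw [J.range_eq_univ, mfderivWithin_univ] at h1 h2
  exact ContinuousLinearMap.inverse_eq h1 h2

/-- A vector field that is smooth in charts is smooth. -/
theorem contMDiff_of_fieldInChart {X : M → V}
    (hX : ∀ p, ContDiffAt ℝ ∞ (fieldInChart J X p) (extChartAt J p p)) :
    ContMDiff J J.tangent ∞ (fun p => (⟨p, X p⟩ : TangentBundle J M)) := by
  have : IsManifold J 1 M := IsManifold.of_le (n := ∞) (by simp)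
  intro p
  rw [Bundle.contMDiffAt_totalSpace]
  refine ⟨contMDiffAt_id, ?_⟩
  have h := (hX p).contMDiffAt.comp p (contMDiffAt_extChartAt (I := J) (n := ∞) (x := p))
  refine h.congr_of_eventuallyEq ?_
  filter_upwards [extChartAt_source_mem_nhds (I := J) p] with q hq
  rw [Function.comp, fieldInChart, inverse_chartFrame_extChartAt J p hq,
    (extChartAt J p).left_inv hq]
  have hq' : q ∈ (chartAt H p).source := by simpa [extChartAt_source] using hq
  have h1 := TangentBundle.continuousLinearMapAt_trivializationAt (I := J) hq'
  refine Eq.trans ?_ (DFunLike.congr_fun h1 (X q))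
  exact (congrFun ((trivializationAt V (TangentSpace J) p).coe_linearMapAt_of_mem (R := ℝ)
    (by simpa using hq')) (X q)).symm

end SmoothField

/-! ### The action on P, fundamental fields and infinitesimal equivariance -/

section Bundle

theorem one_act {G E : Type*} [Group G] (p : G × E) : act 1 p = p := by simp [act]

open Filter Topology

variable {E : Type*} [NormedAddCommGroup E] [NormedSpace ℝ E]
  {G : Type*} [TopologicalSpace G] [ChartedSpace E G] [Group G] [LieGroup 𝓘(ℝ, E) ∞ G]

theorem contMDiff_act_uncurried : ContMDiff (𝓘(ℝ, E).prod (IP E)) (IP E) ∞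
    (fun z : G × (G × E) => act z.1 z.2) :=
  (contMDiff_fst.mul (contMDiff_fst.comp contMDiff_snd)).prodMk (contMDiff_snd.comp contMDiff_snd)

/-- The fundamental vector field with values in the model space. -/
def fundVec (ρ : E) (p : G × E) : E × E :=
  derivMap (J' := 𝓘(ℝ, E)) (J := IP E) (fun g : G => act g p) 1 ρ

/-- The differential of the action as a linear map of the model space. -/
def actDeriv (g : G) (p : G × E) : E × E →L[ℝ] E × E :=
  derivMap (J' := IP E) (J := IP E) (act g) p

/-- The action in charts near the unit and near `p`. -/
abbrev actChart (p : G × E) : E × (E × E) → E × E :=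
  actInChart 𝓘(ℝ, E) (IP E) (act : G → G × E → G × E) 1 p

omit [LieGroup 𝓘(ℝ, E) ∞ G] in
theorem mem_actDomain_act (p : G × E) : (extChartAt 𝓘(ℝ, E) (1 : G) 1, extChartAt (IP E) p p) ∈
    actDomain 𝓘(ℝ, E) (IP E) (act : G → G × E → G × E) 1 p :=
  mem_actDomain _ _ (one_act p)

theorem chartFrame_fderiv_actChart (ρ : E) {p : G × E} {y : E × E}
    (hy : (extChartAt 𝓘(ℝ, E) (1 : G) 1, y) ∈
      actDomain 𝓘(ℝ, E) (IP E) (act : G → G × E → G × E) 1 p) :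
    chartFrame (IP E) p y (fderiv ℝ (actChart p) (extChartAt 𝓘(ℝ, E) (1 : G) 1, y) (ρ, 0)) =
      fundVec ρ ((extChartAt (IP E) p).symm y) := by
  have h := chartFrame_fderiv_actInChart_inl _ _ contMDiff_act_uncurried hy ρ
  rw [actInChart_of_fixed _ _ one_act hy.1.2, chartFrame_self, extChartAt_to_inv] at h
  exact h

theorem fieldInChart_fundVec (ρ : E) (p : G × E) :
    fieldInChart (IP E) (fundVec (G := G) ρ) p =ᶠ[𝓝 (extChartAt (IP E) p p)]
      fun y => fderiv ℝ (actChart p) (extChartAt 𝓘(ℝ, E) (1 : G) 1, y) (ρ, 0) := by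
  filter_upwards [(Continuous.prodMk_right (extChartAt 𝓘(ℝ, E) (1 : G) 1)).continuousAt.eventually
    (actDomain_mem_nhds _ _ contMDiff_act_uncurried (mem_actDomain_act p))] with y hy
  obtain ⟨u, hu⟩ := isInvertible_chartFrame (IP E) p hy.1.2
  have h := chartFrame_fderiv_actChart ρ hy
  rw [fieldInChart, ← h, ← hu]
  simp

theorem contDiffAt_fieldInChart_fundVec (ρ : E) (p : G × E) :
    ContDiffAt ℝ ∞ (fieldInChart (IP E) (fundVec (G := G) ρ) p) (extChartAt (IP E) p p) := by
  have h := (contDiffAt_actInChart _ _ contMDiff_act_uncurried (mem_actDomain_act p)).fderiv_right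
    (m := ∞) (by simp)
  have h' : ContDiffAt ℝ ∞ (fun y => fderiv ℝ (actChart p) (extChartAt 𝓘(ℝ, E) (1 : G) 1, y))
      (extChartAt (IP E) p p) :=
    ContDiffAt.comp (f := fun y => (extChartAt 𝓘(ℝ, E) (1 : G) 1, y)) _ h
      (contDiffAt_const.prodMk contDiffAt_id)
  exact (h'.clm_apply contDiffAt_const).congr_of_eventuallyEq (fieldInChart_fundVec ρ p)

theorem contMDiff_fundVec (ρ : E) : ContMDiff (IP E) (IP E).tangent ∞
    (fun p : G × E => (⟨p, fundVec ρ p⟩ : TangentBundle (IP E) (G × E))) :=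
  contMDiff_of_fieldInChart (IP E) (contDiffAt_fieldInChart_fundVec ρ)

variable [FiniteDimensional ℝ E]

/-- The contraction of the exterior derivative of an equivariant one-form with a fundamental
vector field. -/
theorem extDerivForm_fundVec {α : G × E → E × E →L[ℝ] E} {p : G × E}
    (hα : DifferentiableAt ℝ (formInChart (IP E) α p) (extChartAt (IP E) p p))
    (hequiv : ∀ (g : G) (q : G × E) (X : E × E), α (act g q) (actDeriv g q X) = Ad g (α q X))
    {ρ c : E} (hc : ∀ q, α q (fundVec ρ q) = c) (X : E × E) :
    extDerivForm (IP E) α p (fundVec ρ p) X = lieBr G ρ (α p X) := by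
  obtain ⟨A', hA', hA⟩ := exists_hasFDerivAt_Ad (E := E) G
  have hdom := mem_actDomain_act p
  have hnhds := actDomain_mem_nhds _ _ contMDiff_act_uncurried hdom
  have hfund : fderiv ℝ (actChart p) (extChartAt 𝓘(ℝ, E) (1 : G) 1, extChartAt (IP E) p p) (ρ, 0) =
      fundVec ρ p := by
    have h := chartFrame_fderiv_actChart ρ hdom
    rwa [chartFrame_self, extChartAt_to_inv] at h
  -- In place of Cartan's formula L_{ρ*}α = ι_{ρ*}dα + d(α(ρ*)): the last term vanishes because
  -- α(ρ*) is constant, and the Lie derivative is [ρ, α] by equivariance.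
  have key := fderiv_oneForm_sub_of_equivariant
    (contDiffAt_actInChart _ _ contMDiff_act_uncurried hdom)
    (eventually_of_mem (extChartAt_target_mem_nhds_self (IP E) p)
      fun y hy => actInChart_of_fixed _ _ one_act hy) hα hA' (by
      filter_upwards [(Continuous.prodMk_left (extChartAt (IP E) p p)).continuousAt.eventually
        hnhds] with s hs w
      replace hs : (s, extChartAt (IP E) p p) ∈
        actDomain 𝓘(ℝ, E) (IP E) (act : G → G × E → G × E) 1 p := hs
      have h := chartFrame_fderiv_actInChart_inr _ _ contMDiff_act_uncurried hs w
      have h' : (extChartAt (IP E) p).symm (actChart p (s, extChartAt (IP E) p p)) =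
          act ((extChartAt 𝓘(ℝ, E) (1 : G)).symm s) p := by
        change (extChartAt (IP E) p).symm (extChartAt (IP E) p (act _ _)) = _
        rw [(extChartAt (IP E) p).left_inv hs.2, extChartAt_to_inv]
      rw [formInChart, ContinuousLinearMap.comp_apply, h, h', chartFrame_self, extChartAt_to_inv,
        ContinuousLinearMap.id_apply, formInChart_self]
      exact hequiv _ _ _) ρ c (by
      filter_upwards [(Continuous.prodMk_right
        (extChartAt 𝓘(ℝ, E) (1 : G) 1)).continuousAt.eventually hnhds] with y hy
      rw [formInChart, ContinuousLinearMap.comp_apply, chartFrame_fderiv_actChart ρ hy, hc]) X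
  rw [hfund, formInChart_self, hA] at key
  exact key

/-- The infinitesimal form of the equivariance of `μ`. -/
theorem derivMap_fundVec_of_equivariant {μ : G × E → (E →L[ℝ] ℝ)} (hμ : IsSmoothEquivariant μ)
    (ρ y : E) (p : G × E) :
    derivMap (J' := IP E) (J := 𝓘(ℝ, E →L[ℝ] ℝ)) μ p (fundVec ρ p) y = -μ p (lieBr G ρ y) := by
  obtain ⟨A', hA', hA⟩ := exists_hasFDerivAt_Ad (E := E) G
  set e : E := extChartAt 𝓘(ℝ, E) (1 : G) 1 with he
  have h1 : ContMDiff 𝓘(ℝ, E) (IP E) ∞ (fun g : G => act g p) :=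
    contMDiff_act_uncurried.comp (contMDiff_id.prodMk contMDiff_const)
  have h2 := derivMap_comp (q := (1 : G)) (hμ.smooth.mdifferentiable (by simp) _)
    (h1.mdifferentiable (by simp) 1)
  rw [one_act] at h2
  have h3 : HasFDerivAt (fun s : E => μ (act ((extChartAt 𝓘(ℝ, E) (1 : G)).symm s) p))
      ((derivMap (J' := IP E) (J := 𝓘(ℝ, E →L[ℝ] ℝ)) μ p).comp
        (derivMap (J' := 𝓘(ℝ, E)) (J := IP E) (fun g : G => act g p) 1)) e := by
    have hd1 : MDifferentiableAt 𝓘(ℝ, E) 𝓘(ℝ, E →L[ℝ] ℝ) (fun g : G => μ (act g p)) 1 :=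
      (hμ.smooth.comp h1).mdifferentiable (by simp) 1
    have hd2 : MDifferentiableAt 𝓘(ℝ, E) 𝓘(ℝ, E) (extChartAt 𝓘(ℝ, E) (1 : G)).symm e :=
      (hasMFDerivAt_chartFrame 𝓘(ℝ, E) (1 : G) (mem_extChartAt_target 1)).mdifferentiableAt
    have hd3 : MDifferentiableAt 𝓘(ℝ, E) 𝓘(ℝ, E →L[ℝ] ℝ) (fun g : G => μ (act g p))
        ((extChartAt 𝓘(ℝ, E) (1 : G)).symm e) := by rwa [he, extChartAt_to_inv]
    have hd4 := derivMap_comp hd3 hd2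
    have hd5 : derivMap (J' := 𝓘(ℝ, E)) (J := 𝓘(ℝ, E)) (extChartAt 𝓘(ℝ, E) (1 : G)).symm e =
        ContinuousLinearMap.id ℝ E := chartFrame_self 𝓘(ℝ, E) (1 : G)
    rw [hd5, ContinuousLinearMap.comp_id, he, extChartAt_to_inv, h2] at hd4
    rw [← hd4]
    have hd6 := (hd3.comp e hd2).differentiableAt.hasFDerivAt
    rw [← mfderiv_eq_fderiv] at hd6
    exact hd6
  have h4 := (h3.clm_apply (hA'.clm_apply (hasFDerivAt_const y e)))
  -- The function g ↦ ⟨μ(g·p), Ad_g y⟩ is constant by equivariance; its derivative at the unit gives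
  -- the claim.
  have h5 : (fun s : E => μ (act ((extChartAt 𝓘(ℝ, E) (1 : G)).symm s) p)
      (Ad ((extChartAt 𝓘(ℝ, E) (1 : G)).symm s) y)) = fun _ => μ p y := by
    funext s
    rw [hμ.equivariant, coAd, ContinuousLinearMap.comp_apply, Ad_inv_Ad]
  rw [h5] at h4
  have h6 := DFunLike.congr_fun (h4.unique (hasFDerivAt_const _ _)) ρ
  simp only [he, extChartAt_to_inv, one_act, add_apply, ContinuousLinearMap.comp_apply,
    ContinuousLinearMap.flip_apply, zero_apply, map_zero, zero_add, hA] at h6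
  have hAd : Ad (1 : G) y = y := by
    have h := derivMap_id 𝓘(ℝ, E) (1 : G)
    have hfun : (fun h : G => 1 * h * 1⁻¹) = fun h => h := by funext h; simp
    rw [← hfun] at h
    exact DFunLike.congr_fun h y
  rw [hAd] at h6
  exact eq_neg_of_add_eq_zero_right h6

end Bundle
/-! ### The framing `(θ, L)` and the curvature of `θ` -/

section Framing

open Filter Topology

variable {E : Type*} [NormedAddCommGroup E] [NormedSpace ℝ E] [FiniteDimensional ℝ E]
  {G : Type*} [TopologicalSpace G] [ChartedSpace E G] [Group G] [LieGroup 𝓘(ℝ, E) ∞ G]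

/-- The derivative of Ad is a continuous bilinear map, so the bracket can be handled by the general
rules for linear maps. -/
theorem lieBr_eq_bracketMap (G : Type*) [TopologicalSpace G] [ChartedSpace E G] [Group G]
    [LieGroup 𝓘(ℝ, E) ∞ G] : ∃ B : E →L[ℝ] E →L[ℝ] E, ∀ x y, lieBr G x y = B x y := by
  obtain ⟨B, -, hB⟩ := exists_hasFDerivAt_Ad (E := E) G
  exact ⟨B, fun x y => (hB x y).symm⟩

omit [FiniteDimensional ℝ E] in
theorem lieBr_swap (x y : E) : lieBr G x y = -lieBr G y x := by
  rw [lieBr_eq_fderiv_fderiv, lieBr_eq_fderiv_fderiv, neg_sub]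

/-- A connection form and a non-degenerate horizontal form, with values in the model spaces. -/
structure IsComplexFraming (θ L : G × E → E × E →L[ℝ] E) : Prop where
  smooth_θ : ContMDiff (IP E).tangent 𝓘(ℝ, E) ∞
    (fun v : TangentBundle (IP E) (G × E) => θ v.1 v.2)
  smooth_L : ContMDiff (IP E).tangent 𝓘(ℝ, E) ∞
    (fun v : TangentBundle (IP E) (G × E) => L v.1 v.2)
  equivariant_θ : ∀ (g : G) (q : G × E) (X : E × E), θ (act g q) (actDeriv g q X) = Ad g (θ q X)
  equivariant_L : ∀ (g : G) (q : G × E) (X : E × E), L (act g q) (actDeriv g q X) = Ad g (L q X)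
  θ_fundVec : ∀ (ρ : E) (q : G × E), θ q (fundVec ρ q) = ρ
  L_fundVec : ∀ (ρ : E) (q : G × E), L q (fundVec ρ q) = 0
  ker_L : ∀ (q : G × E) (X : E × E), L q X = 0 → ∃ ρ : E, X = fundVec ρ q

omit [FiniteDimensional ℝ E] in
theorem isComplexFraming_of_forms {θ L : (p : G × E) → TP p →L[ℝ] E}
    (hθ : IsConnectionForm θ) (hL : IsNondegHorizontalForm L) :
    IsComplexFraming (G := G) (E := E) θ L :=
  ⟨hθ.smooth, hL.smooth, hθ.equivariant, hL.equivariant, hθ.fund, hL.horizontal, hL.nondegenerate⟩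

/-- The framing `(θ, L)` at a point. -/
def framing (θ L : G × E → E × E →L[ℝ] E) (p : G × E) : E × E →L[ℝ] E × E := (θ p).prod (L p)

/-- The horizontal vector `Y` with `L Y = ρ`. -/
def horVec (θ L : G × E → E × E →L[ℝ] E) (ρ : E) (p : G × E) : E × E :=
  (framing θ L p).inverse (0, ρ)

/-- The almost complex structure, with values in the model space. -/
def cplxVec (θ L : G × E → E × E →L[ℝ] E) (p : G × E) : E × E →L[ℝ] E × E :=
  (framing θ L p).inverse.comp ((-(L p)).prod (θ p))

variable {θ L : G × E → E × E →L[ℝ] E}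

namespace IsComplexFraming

variable (h : IsComplexFraming θ L)
include h

/-- A vector killed by L is some ρ*, and θ recovers ρ, so the framing is injective; P has twice the
dimension of 𝔤, so it is an endomorphism of a finite-dimensional space. -/
theorem isInvertible_framing (p : G × E) : (framing θ L p).IsInvertible := by
  have hinj : Function.Injective (framing θ L p).toLinearMap := by
    rw [← LinearMap.ker_eq_bot, LinearMap.ker_eq_bot']
    intro X hX
    have h1 : θ p X = 0 := congrArg Prod.fst hX
    have h2 : L p X = 0 := congrArg Prod.snd hX
    obtain ⟨ρ, rfl⟩ := h.ker_L p X h2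
    rw [h.θ_fundVec] at h1
    rw [h1, fundVec, map_zero]
  exact ⟨(LinearEquiv.ofInjectiveEndo _ hinj).toContinuousLinearEquiv, by ext x <;> rfl⟩

theorem ext_iff {p : G × E} {X Y : E × E} : X = Y ↔ θ p X = θ p Y ∧ L p X = L p Y := by
  refine ⟨fun e => by simp [e], fun e => ?_⟩
  obtain ⟨u, hu⟩ := h.isInvertible_framing p
  apply u.injective
  have hu' (Z : E × E) : u Z = (θ p Z, L p Z) := DFunLike.congr_fun hu Z
  rw [hu', hu', e.1, e.2]

theorem framing_inverse (p : G × E) (z : E × E) :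
    θ p ((framing θ L p).inverse z) = z.1 ∧ L p ((framing θ L p).inverse z) = z.2 := by
  obtain ⟨u, hu⟩ := h.isInvertible_framing p
  have h1 : framing θ L p ((framing θ L p).inverse z) = z := by rw [← hu]; simp
  exact ⟨congrArg Prod.fst h1, congrArg Prod.snd h1⟩

theorem θ_horVec (ρ : E) (p : G × E) : θ p (horVec θ L ρ p) = 0 := (h.framing_inverse p _).1

theorem L_horVec (ρ : E) (p : G × E) : L p (horVec θ L ρ p) = ρ := (h.framing_inverse p _).2

theorem θ_cplxVec (p : G × E) (X : E × E) : θ p (cplxVec θ L p X) = -L p X :=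
  (h.framing_inverse p _).1

theorem L_cplxVec (p : G × E) (X : E × E) : L p (cplxVec θ L p X) = θ p X :=
  (h.framing_inverse p _).2

theorem cplxVec_fundVec (ρ : E) (p : G × E) : cplxVec θ L p (fundVec ρ p) = horVec θ L ρ p := by
  rw [h.ext_iff (p := p), h.θ_cplxVec, h.L_cplxVec, h.θ_horVec, h.L_horVec, h.L_fundVec,
    h.θ_fundVec, neg_zero]
  exact ⟨rfl, rfl⟩

theorem eq_fundVec_add_horVec (p : G × E) (X : E × E) :
    X = fundVec (θ p X) p + horVec θ L (L p X) p := by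
  rw [h.ext_iff (p := p)]
  simp [h.θ_horVec, h.L_horVec, h.L_fundVec, h.θ_fundVec]

theorem cplxVec_actDeriv (g : G) (p : G × E) (X : E × E) :
    cplxVec θ L (act g p) (actDeriv g p X) = actDeriv g p (cplxVec θ L p X) := by
  rw [h.ext_iff (p := act g p)]
  simp [h.θ_cplxVec, h.L_cplxVec, h.equivariant_θ, h.equivariant_L]

theorem contDiffAt_θ (p : G × E) :
    ContDiffAt ℝ ∞ (formInChart (IP E) θ p) (extChartAt (IP E) p p) :=
  (contDiffOn_formInChart (IP E) h.smooth_θ p).contDiffAt (extChartAt_target_mem_nhds_self _ p)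

theorem contDiffAt_L (p : G × E) :
    ContDiffAt ℝ ∞ (formInChart (IP E) L p) (extChartAt (IP E) p p) :=
  (contDiffOn_formInChart (IP E) h.smooth_L p).contDiffAt (extChartAt_target_mem_nhds_self _ p)

theorem contDiffAt_inverse_framing (p : G × E) :
    ContDiffAt ℝ ∞ (fun y => (formInChart (IP E) (framing θ L) p y).inverse)
      (extChartAt (IP E) p p) := by
  have h1 : ContDiffAt ℝ ∞ (formInChart (IP E) (framing θ L) p) (extChartAt (IP E) p p) := by
    refine (((contDiffAt_const (c := ContinuousLinearMap.inl ℝ E E)).clm_comp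
      (h.contDiffAt_θ p)).add ((contDiffAt_const (c := ContinuousLinearMap.inr ℝ E E)).clm_comp
      (h.contDiffAt_L p))).congr_of_eventuallyEq (Eventually.of_forall fun y => ?_)
    apply ContinuousLinearMap.ext
    intro X
    simp [formInChart, framing]
  have : CompleteSpace (E × E) := FiniteDimensional.complete ℝ _
  have h2 : (formInChart (IP E) (framing θ L) p (extChartAt (IP E) p p)).IsInvertible := by
    rw [formInChart_self]
    exact h.isInvertible_framing p
  exact ContDiffAt.comp (f := formInChart (IP E) (framing θ L) p) _
    h2.contDiffAt_map_inverse h1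

theorem contDiffAt_horVec (ρ : E) (p : G × E) :
    ContDiffAt ℝ ∞ (fieldInChart (IP E) (horVec θ L ρ) p) (extChartAt (IP E) p p) := by
  refine ((h.contDiffAt_inverse_framing p).clm_apply
    (contDiffAt_const (c := ((0 : E), ρ)))).congr_of_eventuallyEq ?_
  filter_upwards with y
  rw [fieldInChart, horVec, formInChart, (h.isInvertible_framing _).inverse_comp_apply_of_left]

/-- Integrability of the almost complex structure computes the curvature of `θ`. -/
theorem extDerivForm_θ (hI : IsIntegrable (IP E) (M := G × E) (cplxVec θ L)) (p : G × E)
    (X Y : E × E) :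
    extDerivForm (IP E) θ p X Y = lieBr G (θ p X) (θ p Y) - lieBr G (L p X) (L p Y) := by
  obtain ⟨B, hB⟩ := lieBr_eq_bracketMap (E := E) G
  have dθ := (h.contDiffAt_θ p).differentiableAt (n := ∞) (by simp)
  have dL := (h.contDiffAt_L p).differentiableAt (n := ∞) (by simp)
  have dF (ρ : E) := (contDiffAt_fieldInChart_fundVec ρ p).differentiableAt (n := ∞) (by simp)
  have dH (ρ : E) := (h.contDiffAt_horVec ρ p).differentiableAt (n := ∞) (by simp)
  have hθf (ρ : E) (Z : E × E) : extDerivForm (IP E) θ p (fundVec ρ p) Z = lieBr G ρ (θ p Z) :=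
    extDerivForm_fundVec dθ h.equivariant_θ (h.θ_fundVec ρ) Z
  have hLf (ρ : E) (Z : E × E) : extDerivForm (IP E) L p (fundVec ρ p) Z = lieBr G ρ (L p Z) :=
    extDerivForm_fundVec dL h.equivariant_L (h.L_fundVec ρ) Z
  -- Only the horizontal part of dθ needs integrability. Equivariance determines dθ and dL on a
  -- fundamental vector, hence the θ- or L-components of the brackets involving one.
  have hhor (b d : E) : extDerivForm (IP E) θ p (horVec θ L b p) (horVec θ L d p) =
      -lieBr G b d := by
    have e1 := extDerivForm_eq_neg_mlieBracket (IP E) dθ (dH b) (dH d) (h.θ_horVec b)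
      (h.θ_horVec d)
    have e2 := extDerivForm_eq_neg_mlieBracket (IP E) dL (dF b) (dH d) (h.L_fundVec b)
      (h.L_horVec d)
    have e3 := extDerivForm_eq_neg_mlieBracket (IP E) dL (dH b) (dF d) (h.L_horVec b)
      (h.L_fundVec d)
    have e4 := extDerivForm_eq_neg_mlieBracket (IP E) dθ (dF b) (dF d) (h.θ_fundVec b)
      (h.θ_fundVec d)
    rw [hLf, h.L_horVec] at e2
    rw [extDerivForm_swap, hLf, h.L_horVec] at e3
    rw [hθf, h.θ_fundVec] at e4
    have hN := hI (fundVec b) (fundVec d) (contMDiff_fundVec b) (contMDiff_fundVec d) p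
    have hfun (ρ : E) : (fun q : G × E => cplxVec θ L q (fundVec ρ q)) = horVec θ L ρ :=
      funext fun q => h.cplxVec_fundVec ρ q
    let br (X Y : G × E → E × E) : E × E := VectorField.mlieBracket (IP E) (M := G × E) X Y p
    have hN' : br (horVec θ L b) (horVec θ L d) - cplxVec θ L p (br (horVec θ L b) (fundVec d))
        - cplxVec θ L p (br (fundVec b) (horVec θ L d)) - br (fundVec b) (fundVec d) = 0 := by
      rw [← hfun b, ← hfun d]
      exact hN
    change _ = -θ p (br _ _) at e1 e4
    change _ = -L p (br _ _) at e2 e3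
    -- Since θ∘I = −L, the θ-component of the Nijenhuis identity on b*, d* expresses θ[Ib*, Id*]
    -- through the three known brackets: [b,d] + [b,d] − [b,d].
    have hN2 := congrArg (θ p) hN'
    rw [map_zero, map_sub, map_sub, map_sub, h.θ_cplxVec, h.θ_cplxVec] at hN2
    rw [lieBr_swap d b] at e3
    rw [e1]
    have : θ p (br (horVec θ L b) (horVec θ L d)) = lieBr G b d := by
      rw [sub_sub, sub_sub, sub_eq_zero] at hN2
      rw [hN2, ← e2, ← e3, ← neg_neg (θ p (br (fundVec b) (fundVec d))), ← e4]
      abel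
    rw [this]
  conv_lhs => rw [h.eq_fundVec_add_horVec p X]
  rw [extDerivForm_add_left, hθf]
  conv_lhs => rw [h.eq_fundVec_add_horVec p Y]
  rw [extDerivForm_add_right, hhor, extDerivForm_swap, hθf, h.θ_horVec]
  simp [hB, h.θ_fundVec, h.θ_horVec]
  abel

end IsComplexFraming

omit [FiniteDimensional ℝ E] [Group G] [LieGroup 𝓘(ℝ, E) ∞ G] in
theorem pairing_inChart (μ : G × E → (E →L[ℝ] ℝ)) (θ : G × E → E × E →L[ℝ] E) (p : G × E) 
    (y : E × E) : (pairing μ θ).inChart p y = ContinuousAlternatingMap.ofSubsingletonLIE (𝕜 := ℝ) (E := E × E) (F := ℝ)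
      (0 : Fin 1) ((μ ((extChartAt (IP E) p).symm y)).comp (formInChart (IP E) θ p y)) := by
  ext v
  rfl

omit [FiniteDimensional ℝ E] in
theorem contDiffOn_inChart {W : Type*} [NormedAddCommGroup W] [NormedSpace ℝ W] {μ : G × E → W}
    (hμ : ContMDiff (IP E) 𝓘(ℝ, W) ∞ μ) (p : G × E) :
    ContDiffOn ℝ ∞ (fun y => μ ((extChartAt (IP E) p).symm y)) (extChartAt (IP E) p).target :=
  contMDiffOn_iff_contDiffOn.1 (hμ.comp_contMDiffOn (contMDiffOn_extChartAt_symm p))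

theorem contDiffOn_pairing_inChart {μ : G × E → (E →L[ℝ] ℝ)}
    (hμ : ContMDiff (IP E) 𝓘(ℝ, E →L[ℝ] ℝ) ∞ μ) (h : IsComplexFraming θ L) (p : G × E) :
    ContDiffOn ℝ ∞ ((pairing μ θ).inChart p) (extChartAt (IP E) p).target := by
  have h1 := (contDiffOn_inChart hμ p).clm_comp (contDiffOn_formInChart (IP E) h.smooth_θ p)
  have h2 := h1.continuousLinearMap_comp (ContinuousAlternatingMap.ofSubsingletonLIE (𝕜 := ℝ) (E := E × E) (F := ℝ)
      (0 : Fin 1)).toContinuousLinearEquiv.toContinuousLinearMap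
  exact h2.congr fun y _ => pairing_inChart μ θ p y

omit [FiniteDimensional ℝ E] in
theorem hasFDerivAt_inChart {W : Type*} [NormedAddCommGroup W] [NormedSpace ℝ W] {μ : G × E → W}
    (hμ : ContMDiff (IP E) 𝓘(ℝ, W) ∞ μ) (p : G × E) {y : E × E}
    (hy : y ∈ (extChartAt (IP E) p).target) :
    HasFDerivAt (fun y => μ ((extChartAt (IP E) p).symm y))
      (formInChart (IP E) (fun q => derivMap (J' := IP E) (J := 𝓘(ℝ, W)) μ q) p y) y :=
  ((hμ.mdifferentiable (by simp) _).hasMFDerivAt.comp y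
    (hasMFDerivAt_chartFrame (IP E) p hy)).hasFDerivAt

/-- The Leibniz rule d⟨μ,θ⟩ = ⟨dμ ∧ θ⟩ + ⟨μ, dθ⟩, read in the chart at p. -/
theorem d_pairing_apply {μ : G × E → (E →L[ℝ] ℝ)}
    (hμ : ContMDiff (IP E) 𝓘(ℝ, E →L[ℝ] ℝ) ∞ μ) (h : IsComplexFraming θ L) (p : G × E)
    (X Y : E × E) :
    ((pairing μ θ).d p : (E × E) [⋀^Fin 2]→L[ℝ] ℝ) ![X, Y] =
      derivMap (J' := IP E) (J := 𝓘(ℝ, E →L[ℝ] ℝ)) μ p X (θ p Y) -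
      derivMap (J' := IP E) (J := 𝓘(ℝ, E →L[ℝ] ℝ)) μ p Y (θ p X) +
      μ p (extDerivForm (IP E) θ p X Y) := by
  have hd := ((contDiffOn_pairing_inChart hμ h p).contDiffAt
    (extChartAt_target_mem_nhds_self _ p)).differentiableAt (n := ∞) (by simp)
  refine (extDeriv_apply hd ![X, Y]).trans ?_
  have h1 := hasFDerivAt_inChart hμ p (mem_extChartAt_target p)
  have h2 := ((h.contDiffAt_θ p).differentiableAt (by simp)).hasFDerivAt
  have key (w : E × E) := h1.clm_apply (h2.clm_apply (hasFDerivAt_const w _))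
  have hfun (w : E × E) : (fun y => (pairing μ θ).inChart p y ![w]) =
      fun y => μ ((extChartAt (IP E) p).symm y) (formInChart (IP E) θ p y w) := rfl
  have hr0 : (0 : Fin 2).removeNth ![X, Y] = ![Y] := by ext i <;> fin_cases i <;> rfl
  have hr1 : (1 : Fin 2).removeNth ![X, Y] = ![X] := by ext i <;> fin_cases i <;> rfl
  rw [Fin.sum_univ_two, hr0, hr1, hfun, hfun, (key X).fderiv, (key Y).fderiv]
  simp only [extDerivForm, formInChart_self, extChartAt_to_inv, add_apply,
    ContinuousLinearMap.comp_apply, ContinuousLinearMap.flip_apply, zero_apply, map_zero, zero_add,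
    map_sub, Fin.val_zero, Fin.val_one, pow_zero, pow_one, one_smul, neg_smul, Matrix.cons_val_zero,
    Matrix.cons_val_one]
  abel

end Framing
/-! ### Smooth metrics in charts -/

section SmoothMetric

open Filter Topology

variable {V : Type*} [NormedAddCommGroup V] [NormedSpace ℝ V]
  {H : Type*} [TopologicalSpace H] (J : ModelWithCorners ℝ V H)
  {M : Type*} [TopologicalSpace M] [ChartedSpace H M] [IsManifold J ∞ M] [J.Boundaryless]

/-- A field of bilinear forms that is smooth in charts is smooth. -/
theorem contMDiff_bilin_of_inChart {b : M → V →L[ℝ] V →L[ℝ] ℝ}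
    (b' : M → V → V →L[ℝ] V →L[ℝ] ℝ)
    (hb' : ∀ p, ContDiffAt ℝ ∞ (b' p) (extChartAt J p p))
    (hb : ∀ p, ∀ y ∈ (extChartAt J p).target, ∀ v w, b' p y v w =
      b ((extChartAt J p).symm y) (chartFrame J p y v) (chartFrame J p y w)) :
    ContMDiff J (J.prod 𝓘(ℝ, V →L[ℝ] V →L[ℝ] ℝ)) ∞
      (fun p : M => Bundle.TotalSpace.mk' (V →L[ℝ] V →L[ℝ] ℝ)
        (E := fun p : M => TangentSpace J p →L[ℝ] TangentSpace J p →L[ℝ] ℝ) p (b p)) := by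
  have : IsManifold J 1 M := IsManifold.of_le (n := ∞) (by simp)
  intro p
  rw [contMDiffAt_hom_bundle]
  refine ⟨contMDiffAt_id, ?_⟩
  have h := (hb' p).contMDiffAt.comp p (contMDiffAt_extChartAt (I := J) (n := ∞) (x := p))
  refine h.congr_of_eventuallyEq ?_
  filter_upwards [extChartAt_source_mem_nhds (I := J) p] with q hq
  have hq' : q ∈ (chartAt H p).source := by simpa [extChartAt_source] using hq
  have hbase : q ∈ (trivializationAt V (TangentSpace J) p).baseSet := by simpa using hq'
  apply ContinuousLinearMap.ext
  intro v
  apply ContinuousLinearMap.ext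
  intro w
  have h1 := TangentBundle.symmL_trivializationAt (I := J) hq'
  rw [J.range_eq_univ, mfderivWithin_univ] at h1
  have h2 (v : V) : (trivializationAt V (TangentSpace J) p).symm q v =
      chartFrame J p (extChartAt J p q) v :=
    (Bundle.Trivialization.symmL_apply (R := ℝ) _ hbase _).symm.trans (DFunLike.congr_fun h1 v)
  refine (inCoordinates_apply_eq₂ (F₃ := ℝ) (E₃ := Bundle.Trivial M ℝ)
    (ϕ := b q) (v := v) (w := w) hbase hbase (Set.mem_univ _)).trans ?_
  rw [h2 v, h2 w]
  have h3 := hb p _ ((extChartAt J p).map_source hq) v w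
  rw [(extChartAt J p).left_inv hq] at h3
  refine Eq.trans ?_ h3.symm
  simp only [Bundle.Trivial.fiberBundle_trivializationAt', Bundle.Trivial.linearMapAt_trivialization,
    LinearMap.id_coe, id_eq]
  rfl

/-- A positive definite bilinear form on a finite-dimensional space has bounded unit ball. -/
theorem isVonNBounded_of_posDef {V : Type*} [NormedAddCommGroup V] [NormedSpace ℝ V]
    [FiniteDimensional ℝ V] (b : V →L[ℝ] V →L[ℝ] ℝ) (hb : ∀ v, v ≠ 0 → 0 < b v v) :
    Bornology.IsVonNBounded ℝ {v : V | b v v < 1} := by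
  rw [NormedSpace.isVonNBounded_iff]
  have hcont : Continuous fun v => b v v := b.continuous.clm_apply continuous_id
  have : ProperSpace V := FiniteDimensional.proper_real V
  -- The unit sphere is empty only for the zero space. Otherwise the minimum c of the form on the
  -- sphere gives c‖v‖² ≤ b(v,v).
  rcases (Metric.sphere (0 : V) 1).eq_empty_or_nonempty with hS | hS
  · refine (Set.Subsingleton.finite (Set.subsingleton_of_forall_eq (0 : V) fun v _ => ?_)).isBounded
    by_contra hv
    have : ‖v‖⁻¹ • v ∈ Metric.sphere (0 : V) 1 := by
      simp [norm_smul, inv_mul_cancel₀ (norm_ne_zero_iff.2 hv)]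
    rw [hS] at this
    exact this
  · obtain ⟨u, hu, hmin⟩ := (isCompact_sphere (0 : V) 1).exists_isMinOn hS hcont.continuousOn
    have hu0 : u ≠ 0 := by
      rintro rfl
      simp at hu
    have hc := hb u hu0
    -- The bound c⁻¹ + 1 avoids a square root: a longer v would have ‖v‖ > 1 and c‖v‖ > 1, hence
    -- c‖v‖² > 1.
    refine isBounded_iff_forall_norm_le.2 ⟨(b u u)⁻¹ + 1, fun v hv => ?_⟩
    rcases eq_or_ne v 0 with rfl | hv0
    · simp; positivity
    have hn : 0 < ‖v‖ := norm_pos_iff.2 hv0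
    have h1 : b u u ≤ b (‖v‖⁻¹ • v) (‖v‖⁻¹ • v) := hmin (by simp [norm_smul, hn.ne'])
    have h2 : b (‖v‖⁻¹ • v) (‖v‖⁻¹ • v) = (‖v‖⁻¹) ^ 2 * b v v := by
      simp; ring
    have hv' : b v v < 1 := hv
    have h3 : b u u * ‖v‖ ^ 2 ≤ b v v := by
      rw [h2] at h1
      calc b u u * ‖v‖ ^ 2 ≤ (‖v‖⁻¹ ^ 2 * b v v) * ‖v‖ ^ 2 := by gcongr
        _ = b v v := by field_simp
    by_contra hlt
    push Not at hlt
    have h4 : 1 < ‖v‖ := by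
      have : 0 < (b u u)⁻¹ := inv_pos.2 hc
      linarith
    have h5 : 1 < b u u * ‖v‖ := by
      have : b u u * (b u u)⁻¹ = 1 := mul_inv_cancel₀ hc.ne'
      nlinarith
    nlinarith

end SmoothMetric

/-! ### Linear algebra at a point -/

section Pointwise

variable {E : Type*} [NormedAddCommGroup E] [NormedSpace ℝ E]

theorem symmForm_iff_symm (Φ : (E →L[ℝ] ℝ) ≃L[ℝ] E) :
    SymmForm (Φ : (E →L[ℝ] ℝ) →L[ℝ] E) ↔ ∀ ρ σ, Φ.symm ρ σ = Φ.symm σ ρ := by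
  constructor
  · intro h ρ σ
    simpa using h (Φ.symm ρ) (Φ.symm σ)
  · intro h x y
    simpa using h (Φ y) (Φ x) |>.symm

/-- Symmetry moves the outer Φ onto x, and skewness of B then produces the minus sign. The
right-hand side is the Schur complement of the metric at σ = Φ(x). -/
theorem posDefForm_apply_symm {Φ : (E →L[ℝ] ℝ) ≃L[ℝ] E} {B : E →L[ℝ] E →L[ℝ] ℝ}
    (hB : ∀ x y, B x y = -B y x) (hΦ : ∀ ρ σ, Φ.symm ρ σ = Φ.symm σ ρ) (x : E →L[ℝ] ℝ) :
    x (((Φ : (E →L[ℝ] ℝ) →L[ℝ] E) + (Φ : (E →L[ℝ] ℝ) →L[ℝ] E).comp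
      ((B.comp (Φ : (E →L[ℝ] ℝ) →L[ℝ] E)) ^ 2) : (E →L[ℝ] ℝ) →L[ℝ] E) x) =
      Φ.symm (Φ x) (Φ x) - B (Φ x) (Φ (B (Φ x))) := by
  have h1 := (symmForm_iff_symm Φ).2 hΦ x (B (Φ (B (Φ x))))
  have h2 : ((B.comp (Φ : (E →L[ℝ] ℝ) →L[ℝ] E)) ^ 2) x = B (Φ (B (Φ x))) := rfl
  simp only [add_apply, ContinuousLinearMap.comp_apply, h2,
    map_add, ContinuousLinearEquiv.coe_coe, ContinuousLinearEquiv.symm_apply_apply] at h1 ⊢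
  rw [h1, hB, sub_eq_add_neg]

/-- The metric is positive definite if and only if the two forms on the dual space are. -/
theorem posDef_iff {Φ : (E →L[ℝ] ℝ) ≃L[ℝ] E} {B : E →L[ℝ] E →L[ℝ] ℝ}
    (hB : ∀ x y, B x y = -B y x) (hΦ : ∀ ρ σ, Φ.symm ρ σ = Φ.symm σ ρ) :
    (PosDefForm (Φ : (E →L[ℝ] ℝ) →L[ℝ] E) ∧
      PosDefForm ((Φ : (E →L[ℝ] ℝ) →L[ℝ] E) + (Φ : (E →L[ℝ] ℝ) →L[ℝ] E).comp
      ((B.comp (Φ : (E →L[ℝ] ℝ) →L[ℝ] E)) ^ 2))) ↔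
    ∀ ρ σ : E, ρ ≠ 0 ∨ σ ≠ 0 → 0 < Φ.symm σ σ + Φ.symm ρ ρ + 2 * B σ ρ := by
  -- Completing the square in ρ for fixed σ.
  have hsq (ρ σ : E) : Φ.symm σ σ + Φ.symm ρ ρ + 2 * B σ ρ =
      Φ.symm (ρ + Φ (B σ)) (ρ + Φ (B σ)) + (Φ.symm σ σ - B σ (Φ (B σ))) := by
    have := hΦ ρ (Φ (B σ))
    simp only [map_add, add_apply, ContinuousLinearEquiv.symm_apply_apply] at this ⊢
    rw [this]
    ring
  have hpos (h : PosDefForm (Φ : (E →L[ℝ] ℝ) →L[ℝ] E)) (τ : E) (hτ : τ ≠ 0) :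
      0 < Φ.symm τ τ := by
    simpa using h (Φ.symm τ) (by simpa using hτ)
  constructor
  · rintro ⟨h1, h2⟩ ρ σ hne
    rw [hsq]
    have hτ : 0 ≤ Φ.symm (ρ + Φ (B σ)) (ρ + Φ (B σ)) := by
      rcases eq_or_ne (ρ + Φ (B σ)) 0 with h | h
      · simp [h]
      · exact (hpos h1 _ h).le
    rcases eq_or_ne σ 0 with rfl | hσ
    · have hρ : ρ ≠ 0 := by simpa using hne
      simpa using hpos h1 ρ hρ
    · have := h2 (Φ.symm σ) (by simpa using hσ)
      rw [posDefForm_apply_symm hB hΦ, ContinuousLinearEquiv.apply_symm_apply] at this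
      linarith
  · intro h
    refine ⟨fun x hx => ?_, fun x hx => ?_⟩
    · simpa using h 0 (Φ x) (Or.inr (by simpa using hx))
    · rw [posDefForm_apply_symm hB hΦ]
      -- This ρ makes the square vanish, leaving only the Schur complement.
      have := h (-Φ (B (Φ x))) (Φ x) (Or.inr (by simpa using hx))
      rw [hsq] at this
      simpa using this

end Pointwise
/-! ### The metric determined by a moment map -/

section Metric

open Filter Topology

variable {E : Type*} [NormedAddCommGroup E] [NormedSpace ℝ E] [FiniteDimensional ℝ E]
  {G : Type*} [TopologicalSpace G] [ChartedSpace E G] [Group G] [LieGroup 𝓘(ℝ, E) ∞ G]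

theorem contDiffAt_flip {V W : Type*} [NormedAddCommGroup V] [NormedSpace ℝ V]
    [NormedAddCommGroup W] [NormedSpace ℝ W] [FiniteDimensional ℝ V] [FiniteDimensional ℝ W]
    {D : V → V →L[ℝ] W →L[ℝ] ℝ} {y : V}
    (hD : ContDiffAt ℝ ∞ D y) : ContDiffAt ℝ ∞ (fun z => (D z).flip) y := by
  have hF : ContDiff ℝ ∞ (fun B : V →L[ℝ] W →L[ℝ] ℝ => B.flip) :=
    contDiff_clm_apply_iff.2 fun w => contDiff_clm_apply_iff.2 fun v =>
      (contDiff_id.clm_apply contDiff_const).clm_apply contDiff_const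
  exact hF.contDiffAt.comp y hD

/-- The differential of `μ`, with values in the model spaces. -/
def momentDeriv (μ : G × E → (E →L[ℝ] ℝ)) (p : G × E) : E × E →L[ℝ] (E →L[ℝ] ℝ) :=
  derivMap (J' := IP E) (J := 𝓘(ℝ, E →L[ℝ] ℝ)) μ p

/-- The bilinear form `(X, Y) ↦ ⟨dμ(Y), L X⟩ + ⟨dμ(I Y), θ X⟩`. -/
def momentMetric (θ L : G × E → E × E →L[ℝ] E) (μ : G × E → (E →L[ℝ] ℝ)) (p : G × E) :
    E × E →L[ℝ] E × E →L[ℝ] ℝ :=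
  (momentDeriv μ p).flip.comp (L p) +
    ((momentDeriv μ p).comp (cplxVec θ L p)).flip.comp (θ p)

omit [FiniteDimensional ℝ E] [Group G] [LieGroup 𝓘(ℝ, E) ∞ G] in
theorem momentMetric_apply (θ L : G × E → E × E →L[ℝ] E) (μ : G × E → (E →L[ℝ] ℝ)) (p : G × E)
    (X Y : E × E) : momentMetric θ L μ p X Y =
      momentDeriv μ p Y (L p X) + momentDeriv μ p (cplxVec θ L p Y) (θ p X) := rfl

variable {θ L : G × E → E × E →L[ℝ] E} {μ : G × E → (E →L[ℝ] ℝ)}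

theorem ad_swap (ξ : E →L[ℝ] ℝ) (x y : E) : ad G ξ x y = -ad G ξ y x := by
  change ξ (lieBr G x y) = -ξ (lieBr G y x)
  rw [lieBr_swap, map_neg]

-- Differentiate μ(g·q) = Ad*_g μ(q), whose right side is a fixed linear map applied to μ; pairing
-- with Ad_g x cancels the coadjoint twist. Together with the equivariance of θ, L and I this makes
-- `momentMetric` invariant.
omit [FiniteDimensional ℝ E] in
theorem momentDeriv_actDeriv (hμ : IsSmoothEquivariant μ) (g : G) (p : G × E) (X : E × E) (x : E) :
    momentDeriv μ (act g p) (actDeriv g p X) (Ad g x) = momentDeriv μ p X x := by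
  have hact : ContMDiff (IP E) (IP E) ∞ (act g : G × E → G × E) :=
    contMDiff_act_uncurried.comp (contMDiff_const.prodMk contMDiff_id)
  have h1 := derivMap_comp (q := p) (hμ.smooth.mdifferentiable (by simp) _)
    (hact.mdifferentiable (by simp) p)
  let C : (E →L[ℝ] ℝ) →L[ℝ] (E →L[ℝ] ℝ) := (ContinuousLinearMap.compL ℝ E E ℝ).flip (Ad g⁻¹)
  have h2 : derivMap (J' := IP E) (J := 𝓘(ℝ, E →L[ℝ] ℝ)) (fun x => C (μ x)) p =
      C.comp (momentDeriv μ p) :=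
    (derivMap_comp (J := 𝓘(ℝ, E →L[ℝ] ℝ)) (J'' := 𝓘(ℝ, E →L[ℝ] ℝ)) (h := C) (q := p)
      C.differentiableAt.mdifferentiableAt (hμ.smooth.mdifferentiable (by simp) p)).trans
      (congrArg (fun D : (E →L[ℝ] ℝ) →L[ℝ] (E →L[ℝ] ℝ) => D.comp (momentDeriv μ p))
        (mfderiv_eq_fderiv.trans C.fderiv))
  have h3 : (fun q => μ (act g q)) = fun q => C (μ q) := funext fun q => hμ.equivariant g q
  rw [h3, h2] at h1
  have h4 := DFunLike.congr_fun (DFunLike.congr_fun h1 X) (Ad g x)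
  refine h4.symm.trans ?_
  change momentDeriv μ p X (Ad g⁻¹ (Ad g x)) = _
  rw [Ad_inv_Ad]

namespace IsComplexFraming

variable (h : IsComplexFraming θ L)
include h

theorem momentMetric_actDeriv (hμ : IsSmoothEquivariant μ) (g : G) (p : G × E) (X Y : E × E) :
    momentMetric θ L μ (act g p) (actDeriv g p X) (actDeriv g p Y) = momentMetric θ L μ p X Y := by
  simp only [momentMetric_apply, h.cplxVec_actDeriv, h.equivariant_L, h.equivariant_θ,
    momentDeriv_actDeriv hμ]

/-- In charts, the bilinear form `momentMetric` is smooth. -/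
theorem contMDiff_momentMetric (hμ : ContMDiff (IP E) 𝓘(ℝ, E →L[ℝ] ℝ) ∞ μ) :
    ContMDiff (IP E) ((IP E).prod 𝓘(ℝ, E × E →L[ℝ] E × E →L[ℝ] ℝ)) ∞
      (fun p : G × E => Bundle.TotalSpace.mk' (E × E →L[ℝ] E × E →L[ℝ] ℝ)
        (E := fun p : G × E => TP p →L[ℝ] TP p →L[ℝ] ℝ) p (momentMetric θ L μ p)) := by
  let D (p : G × E) := formInChart (IP E) (momentDeriv μ) p
  -- T is the almost complex structure in the chart: the inverse of the chart expression of (θ, L),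
  -- applied to (−L, θ).
  let T (p : G × E) (y : E × E) : E × E →L[ℝ] E × E :=
    (formInChart (IP E) (framing θ L) p y).inverse.comp
      ((ContinuousLinearMap.inr ℝ E E).comp (formInChart (IP E) θ p y) -
        (ContinuousLinearMap.inl ℝ E E).comp (formInChart (IP E) L p y))
  refine contMDiff_bilin_of_inChart (IP E) (b := momentMetric θ L μ)
    (fun p y => (D p y).flip.comp (formInChart (IP E) L p y) +
      ((D p y).comp (T p y)).flip.comp (formInChart (IP E) θ p y)) ?_ ?_
  · intro p
    have hθ := h.contDiffAt_θ p
    have hL := h.contDiffAt_L p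
    have hD : ContDiffAt ℝ ∞ (D p) (extChartAt (IP E) p p) := by
      have h1 := ((contDiffOn_inChart hμ p).contDiffAt
        (extChartAt_target_mem_nhds_self _ p)).fderiv_right (m := ∞) (by simp)
      refine h1.congr_of_eventuallyEq ?_
      filter_upwards [extChartAt_target_mem_nhds_self (IP E) p] with y hy
      exact (hasFDerivAt_inChart hμ p hy).fderiv.symm
    have hT : ContDiffAt ℝ ∞ (T p) (extChartAt (IP E) p p) :=
      (h.contDiffAt_inverse_framing p).clm_comp
        ((contDiffAt_const.clm_comp hθ).sub (contDiffAt_const.clm_comp hL))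
    exact ((contDiffAt_flip hD).clm_comp hL).add
      ((contDiffAt_flip (hD.clm_comp hT)).clm_comp hθ)
  · intro p y hy v w
    have hTw : chartFrame (IP E) p y (T p y w) =
        cplxVec θ L ((extChartAt (IP E) p).symm y) (chartFrame (IP E) p y w) := by
      obtain ⟨u, hu⟩ := isInvertible_chartFrame (IP E) p hy
      have h1 : T p y w = (chartFrame (IP E) p y).inverse
          ((framing θ L ((extChartAt (IP E) p).symm y)).inverse
            (-L ((extChartAt (IP E) p).symm y) (chartFrame (IP E) p y w),
              θ ((extChartAt (IP E) p).symm y) (chartFrame (IP E) p y w))) := by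
        simp only [T, formInChart, ContinuousLinearMap.comp_apply,
          (h.isInvertible_framing _).inverse_comp_of_left]
        simp
      rw [h1, ← hu]
      simp [cplxVec]
    simp only [momentMetric_apply, ← hTw]
    rfl

variable (hμ : IsSmoothEquivariant μ)
include hμ

theorem covDeriv_fundVec (ρ : E) (p : G × E) :
    momentDeriv μ p (fundVec ρ p) + ad G (μ p) (θ p (fundVec ρ p)) = 0 := by
  ext y
  rw [h.θ_fundVec]
  change momentDeriv μ p (fundVec ρ p) y + μ p (lieBr G ρ y) = 0
  rw [momentDeriv, derivMap_fundVec_of_equivariant hμ, neg_add_cancel]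

end IsComplexFraming

/-- The defining relation `L = Φ ∘ Dμ` at the point `p`. -/
def IsLegendre (θ L : G × E → E × E →L[ℝ] E) (μ : G × E → (E →L[ℝ] ℝ)) (p : G × E)
    (Φ : (E →L[ℝ] ℝ) ≃L[ℝ] E) : Prop :=
  ∀ X, L p X = Φ (momentDeriv μ p X + ad G (μ p) (θ p X))

theorem IsLegendre.momentDeriv_apply {p : G × E} {Φ : (E →L[ℝ] ℝ) ≃L[ℝ] E}
    (hΦ : IsLegendre θ L μ p Φ) (X : E × E) (y : E) :
    momentDeriv μ p X y = Φ.symm (L p X) y - ad G (μ p) (θ p X) y := by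
  rw [hΦ X, ContinuousLinearEquiv.symm_apply_apply, add_apply, add_sub_cancel_right]

/-- Substitute dμ = Φ⁻¹L − (ad μ)θ and use that I turns (θ, L) into (−L, θ). Symmetry of Φ is not
available here, so the order of the arguments of Φ⁻¹ matters. -/
theorem IsLegendre.momentMetric_eq (h : IsComplexFraming θ L) {p : G × E}
    {Φ : (E →L[ℝ] ℝ) ≃L[ℝ] E} (hΦ : IsLegendre θ L μ p Φ) (X Y : E × E) :
    momentMetric θ L μ p X Y = Φ.symm (L p Y) (L p X) + Φ.symm (θ p Y) (θ p X) +
      (ad G (μ p) (L p X) (θ p Y) - ad G (μ p) (θ p X) (L p Y)) := by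
  rw [momentMetric_apply, hΦ.momentDeriv_apply, hΦ.momentDeriv_apply, h.θ_cplxVec, h.L_cplxVec,
    ad_swap (G := G) (μ p) (θ p Y), ad_swap (G := G) (μ p) (-L p Y)]
  simp only [map_neg]
  ring

/-- The dμ-terms contribute −2⟨μ,[θX,θY]⟩ and the curvature adds ⟨μ,[θX,θY]⟩ − ⟨μ,[LX,LY]⟩, which
gives the bracket terms of the metric. The Φ⁻¹-terms match only by symmetry of Φ. -/
theorem IsLegendre.d_pairing (h : IsComplexFraming θ L) (hμ : IsSmoothEquivariant μ)
    (hI : IsIntegrable (IP E) (M := G × E) (cplxVec θ L)) {p : G × E}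
    {Φ : (E →L[ℝ] ℝ) ≃L[ℝ] E} (hΦ : IsLegendre θ L μ p Φ)
    (hsymm : ∀ ρ σ, Φ.symm ρ σ = Φ.symm σ ρ) (X Y : E × E) :
    ((pairing μ θ).d p : (E × E) [⋀^Fin 2]→L[ℝ] ℝ) ![X, Y] =
      -momentMetric θ L μ p (cplxVec θ L p X) Y := by
  rw [d_pairing_apply hμ.smooth h, h.extDerivForm_θ hI, hΦ.momentMetric_eq h, h.θ_cplxVec,
    h.L_cplxVec]
  change momentDeriv μ p X (θ p Y) - momentDeriv μ p Y (θ p X) + _ = _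
  rw [hΦ.momentDeriv_apply, hΦ.momentDeriv_apply, map_sub]
  change _ + (ad G (μ p) (θ p X) (θ p Y) - ad G (μ p) (L p X) (L p Y)) = _
  rw [ad_swap (G := G) (μ p) (θ p Y) (θ p X), hsymm (θ p Y)]
  simp only [map_neg, neg_apply]
  ring

/-- If `μ` is regular at `p`, then `L = Φ ∘ Dμ` for some invertible `Φ`. -/
theorem exists_isLegendre (h : IsComplexFraming θ L) (hμ : IsSmoothEquivariant μ) (p : G × E)
    (hreg : ∀ X : E × E, momentDeriv μ p X + ad G (μ p) (θ p X) = 0 → ∃ ρ : E, X = fundVec ρ p) :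
    ∃ Φ, IsLegendre θ L μ p Φ := by
  let hor : E →L[ℝ] E × E := (framing θ L p).inverse.comp (.inr ℝ E E)
  -- Dμ restricted to horizontal vectors, which L identifies with 𝔤. Regularity makes it injective,
  -- equality of dimensions makes it invertible, and Φ is its inverse.
  let Ψ : E →L[ℝ] (E →L[ℝ] ℝ) := (momentDeriv μ p).comp hor
  have hΨ (X : E × E) : Ψ (L p X) = momentDeriv μ p X + ad G (μ p) (θ p X) := by
    have h1 := h.covDeriv_fundVec hμ (θ p X) p
    conv_rhs => rw [h.eq_fundVec_add_horVec p X]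
    rw [map_add, map_add, h.θ_horVec, add_zero, add_right_comm, h1, zero_add]
    rfl
  have hinj : Function.Injective Ψ := by
    rw [injective_iff_map_eq_zero]
    intro ρ hρ
    have h1 := hΨ (horVec θ L ρ p)
    rw [h.L_horVec, hρ] at h1
    obtain ⟨σ, hσ⟩ := hreg _ h1.symm
    rw [← h.L_horVec ρ p, hσ, h.L_fundVec]
  have hdim : Module.finrank ℝ E = Module.finrank ℝ (E →L[ℝ] ℝ) := by
    rw [← (LinearMap.toContinuousLinearMap (𝕜 := ℝ) (E := E) (F' := ℝ)).finrank_eq]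
    exact (Subspace.dual_finrank_eq (K := ℝ) (V := E)).symm
  let e : E ≃L[ℝ] (E →L[ℝ] ℝ) :=
    (LinearEquiv.ofInjectiveOfFinrankEq Ψ.toLinearMap hinj hdim).toContinuousLinearEquiv
  refine ⟨e.symm, fun X => ?_⟩
  rw [← hΨ X]
  exact (e.symm_apply_apply (L p X)).symm

/-- L is onto, so the relation determines Φ⁻¹ at every ρ, by evaluation on horizontal vectors. -/
theorem IsLegendre.unique (h : IsComplexFraming θ L) {p : G × E} {Φ Φ' : (E →L[ℝ] ℝ) ≃L[ℝ] E}
    (hΦ : IsLegendre θ L μ p Φ) (hΦ' : IsLegendre θ L μ p Φ') : Φ = Φ' := by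
  have key (ρ : E) : Φ.symm ρ = Φ'.symm ρ := by
    have h1 := hΦ (horVec θ L ρ p)
    have h2 := hΦ' (horVec θ L ρ p)
    rw [h.L_horVec] at h1 h2
    exact (Φ.symm_apply_eq.2 h1).trans (Φ'.symm_apply_eq.2 h2).symm
  ext x
  have := key (Φ x)
  rw [Φ.symm_apply_apply] at this
  conv_rhs => rw [this]
  simp

end Metric
/-! ### Kähler metrics with a prescribed moment map -/

section Kahler

variable {E : Type*} [NormedAddCommGroup E] [NormedSpace ℝ E] [FiniteDimensional ℝ E]
  {G : Type*} [TopologicalSpace G] [ChartedSpace E G] [Group G] [LieGroup 𝓘(ℝ, E) ∞ G]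
  {θ L : G × E → E × E →L[ℝ] E} {μ : G × E → (E →L[ℝ] ℝ)} {p : G × E}
  {Φ : (E →L[ℝ] ℝ) ≃L[ℝ] E}

/-- A Hermitian form for which `μ` satisfies the moment map condition is `momentMetric`. -/
theorem IsComplexFraming.eq_momentMetric (h : IsComplexFraming θ L)
    {b : E × E →L[ℝ] E × E →L[ℝ] ℝ}
    (hherm : ∀ X Y, b (cplxVec θ L p X) (cplxVec θ L p Y) = b X Y)
    (hmom : ∀ ρ X, momentDeriv μ p X ρ = b (cplxVec θ L p (fundVec ρ p)) X) (X Y : E × E) :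
    b X Y = momentMetric θ L μ p X Y := by
  -- The two terms become b(I(LX)*, Y) and b((θX)*, Y), the latter by I-invariance; their first
  -- arguments add up to X.
  rw [momentMetric_apply, hmom, hmom, hherm, h.cplxVec_fundVec, add_comm, ← add_apply, ← map_add,
    ← h.eq_fundVec_add_horVec]

theorem IsComplexFraming.momentMetric_cplxVec_fundVec (h : IsComplexFraming θ L) (ρ : E)
    (X : E × E) :
    momentMetric θ L μ p (cplxVec θ L p (fundVec ρ p)) X = momentDeriv μ p X ρ := by
  rw [h.cplxVec_fundVec, momentMetric_apply, h.L_horVec, h.θ_horVec, map_zero, add_zero]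

namespace IsLegendre

variable (h : IsComplexFraming θ L) (hΦ : IsLegendre θ L μ p Φ)
include h hΦ

/-- On horizontal vectors the bracket terms vanish and the metric is Φ⁻¹ itself. -/
theorem symm_of_momentMetric_symm
    (hsymm : ∀ X Y, momentMetric θ L μ p X Y = momentMetric θ L μ p Y X) (ρ σ : E) :
    Φ.symm ρ σ = Φ.symm σ ρ := by
  have h1 := hsymm (horVec θ L σ p) (horVec θ L ρ p)
  simpa [hΦ.momentMetric_eq h, h.θ_horVec, h.L_horVec] using h1

theorem momentMetric_symm (hsymm : ∀ ρ σ, Φ.symm ρ σ = Φ.symm σ ρ) (X Y : E × E) :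
    momentMetric θ L μ p X Y = momentMetric θ L μ p Y X := by
  rw [hΦ.momentMetric_eq h, hΦ.momentMetric_eq h, hsymm (L p X), hsymm (θ p X),
    ad_swap (G := G) (μ p) (L p X), ad_swap (G := G) (μ p) (θ p X)]
  ring

theorem momentMetric_cplxVec (X Y : E × E) :
    momentMetric θ L μ p (cplxVec θ L p X) (cplxVec θ L p Y) = momentMetric θ L μ p X Y := by
  simp only [hΦ.momentMetric_eq h, h.θ_cplxVec, h.L_cplxVec, map_neg, neg_apply]
  ring

theorem momentMetric_self (X : E × E) : momentMetric θ L μ p X X =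
    Φ.symm (L p X) (L p X) + Φ.symm (θ p X) (θ p X) + 2 * ad G (μ p) (L p X) (θ p X) := by
  rw [hΦ.momentMetric_eq h, ad_swap (G := G) (μ p) (θ p X)]
  ring

theorem momentMetric_pos_iff (hsymm : ∀ ρ σ, Φ.symm ρ σ = Φ.symm σ ρ) :
    (∀ X, X ≠ 0 → 0 < momentMetric θ L μ p X X) ↔
      PosDefForm (Φ : (E →L[ℝ] ℝ) →L[ℝ] E) ∧
        PosDefForm ((Φ : (E →L[ℝ] ℝ) →L[ℝ] E) + (Φ : (E →L[ℝ] ℝ) →L[ℝ] E).comp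
          (((ad G (μ p)).comp (Φ : (E →L[ℝ] ℝ) →L[ℝ] E)) ^ 2)) := by
  rw [posDef_iff (ad_swap (G := G) (μ p)) hsymm]
  constructor
  · intro H ρ σ hne
    -- The vector with θ-component ρ and L-component σ: positivity on tangent vectors is positivity
    -- on pairs (ρ, σ).
    have hX : fundVec ρ p + horVec θ L σ p ≠ 0 := by
      rw [Ne, h.ext_iff (p := p)]
      simp only [map_add, h.θ_fundVec, h.L_fundVec, h.θ_horVec, h.L_horVec, add_zero, zero_add,
        map_zero]
      tauto
    have h1 := H _ hX
    rw [hΦ.momentMetric_self h] at h1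
    simpa only [map_add, h.θ_fundVec, h.L_fundVec, h.θ_horVec, h.L_horVec, add_zero,
      zero_add] using h1
  · intro H X hX
    rw [hΦ.momentMetric_self h]
    refine H _ _ ?_
    rw [Ne, h.ext_iff (p := p), map_zero, map_zero] at hX
    tauto

end IsLegendre

/-- The Riemannian metric determined by a moment map. -/
def kahlerMetric (h : IsComplexFraming θ L) (hμ : IsSmoothEquivariant μ)
    (hsymm : ∀ p X Y, momentMetric θ L μ p X Y = momentMetric θ L μ p Y X)
    (hpos : ∀ p X, X ≠ 0 → 0 < momentMetric θ L μ p X X) : Metric E G where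
  inner := momentMetric θ L μ
  symm := hsymm
  pos := hpos
  isVonNBounded p := isVonNBounded_of_posDef _ (hpos p)
  contMDiff := h.contMDiff_momentMetric hμ.smooth

theorem isInvariantKahler_kahlerMetric (h : IsComplexFraming θ L) (hμ : IsSmoothEquivariant μ)
    (hI : IsIntegrable (IP E) (M := G × E) (cplxVec θ L))
    {Φ : G × E → (E →L[ℝ] ℝ) ≃L[ℝ] E} (hΦ : ∀ p, IsLegendre θ L μ p (Φ p))
    (hΦsymm : ∀ p ρ σ, (Φ p).symm ρ σ = (Φ p).symm σ ρ)
    (hsymm : ∀ p X Y, momentMetric θ L μ p X Y = momentMetric θ L μ p Y X)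
    (hpos : ∀ p X, X ≠ 0 → 0 < momentMetric θ L μ p X X) :
    IsInvariantKahler (cplx (G := G) θ L) (kahlerMetric h hμ hsymm hpos)
      (-(pairing (G := G) μ θ).d) where
  invariant := h.momentMetric_actDeriv hμ
  hermitian p := (hΦ p).momentMetric_cplxVec h
  kahlerForm p X Y :=
    neg_eq_iff_eq_neg.2 ((hΦ p).d_pairing h hμ hI (hΦsymm p) X Y)
  closed := by
    rw [d_neg, d_d_eq_zero (IP E) (contDiffOn_pairing_inChart hμ.smooth h), neg_zero]

theorem isMomentMap_neg_d_pairing (h : IsComplexFraming θ L) (hμ : IsSmoothEquivariant μ)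
    (hI : IsIntegrable (IP E) (M := G × E) (cplxVec θ L))
    {Φ : G × E → (E →L[ℝ] ℝ) ≃L[ℝ] E} (hΦ : ∀ p, IsLegendre θ L μ p (Φ p))
    (hΦsymm : ∀ p ρ σ, (Φ p).symm ρ σ = (Φ p).symm σ ρ) :
    IsMomentMap μ (-(pairing (G := G) μ θ).d) := fun ρ p X =>
  (h.momentMetric_cplxVec_fundVec ρ X).symm.trans
    (neg_eq_iff_eq_neg.2 ((hΦ p).d_pairing h hμ hI (hΦsymm p) (fundVec ρ p) X)).symm

/-- Every admissible metric is the same explicit form. Necessity of the conditions on Φ and the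
formulas for g and ω all pass through this identification. -/
theorem inner_eq_momentMetric (h : IsComplexFraming θ L) {g : Metric E G}
    {κ : DiffForm (IP E) (M := G × E) 2} (hg : IsInvariantKahler (cplx (G := G) θ L) g κ)
    (hκ : IsMomentMap μ κ) (p : G × E) (X Y : E × E) :
    (g.inner p : E × E →L[ℝ] E × E →L[ℝ] ℝ) X Y = momentMetric θ L μ p X Y :=
  h.eq_momentMetric (hg.hermitian p)
    (fun ρ X => (hκ ρ p X).trans (hg.kahlerForm p (fundVec ρ p) X)) X Y

theorem momentMetric_symm_of_inner (h : IsComplexFraming θ L) {g : Metric E G}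
    {κ : DiffForm (IP E) (M := G × E) 2} (hg : IsInvariantKahler (cplx (G := G) θ L) g κ)
    (hκ : IsMomentMap μ κ) (p : G × E) (X Y : E × E) :
    momentMetric θ L μ p X Y = momentMetric θ L μ p Y X :=
  (inner_eq_momentMetric h hg hκ p X Y).symm.trans
    ((g.symm p X Y).trans (inner_eq_momentMetric h hg hκ p Y X))

/-- Symmetry of g forces symmetry of Φ, after which both sides are `momentMetric`(I·,·). -/
theorem kahlerForm_eq_neg_d_pairing (h : IsComplexFraming θ L) (hμ : IsSmoothEquivariant μ)
    (hI : IsIntegrable (IP E) (M := G × E) (cplxVec θ L))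
    {Φ : G × E → (E →L[ℝ] ℝ) ≃L[ℝ] E} (hΦ : ∀ p, IsLegendre θ L μ p (Φ p)) {g : Metric E G}
    {κ : DiffForm (IP E) (M := G × E) 2} (hg : IsInvariantKahler (cplx (G := G) θ L) g κ)
    (hκ : IsMomentMap μ κ) : κ = -(pairing (G := G) μ θ).d := by
  funext p
  apply ContinuousAlternatingMap.ext
  intro v
  have hv : v = ![v 0, v 1] := by
    funext i
    fin_cases i <;> rfl
  have hs := (hΦ p).symm_of_momentMetric_symm h (momentMetric_symm_of_inner h hg hκ p)
  have h1 := (hΦ p).d_pairing h hμ hI hs (v 0) (v 1)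
  rw [hv]
  exact (hg.kahlerForm p _ _).trans ((inner_eq_momentMetric h hg hκ p _ _).trans
    (neg_eq_iff_eq_neg.2 h1).symm)

end Kahler
end KahlerGC

end

/-! ### The main theorem -/

open KahlerGC in
theorem mainTheorem4 {E : Type*} [NormedAddCommGroup E] [NormedSpace ℝ E] [FiniteDimensional ℝ E]
    {G : Type*} [TopologicalSpace G] [ChartedSpace E G] [Group G] [LieGroup 𝓘(ℝ, E) ∞ G]
    (θ L : (p : G × E) → TP p →L[ℝ] E)
    (hθ : IsConnectionForm θ) (hL : IsNondegHorizontalForm L)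
    (hI : IsIntegrable (IP E) (cplx θ L))
    (μ : G × E → (E →L[ℝ] ℝ)) (hμ : IsSmoothEquivariant μ)
    (hreg : IsRegular θ μ) :
    (∃! Φ : G × E → ((E →L[ℝ] ℝ) ≃L[ℝ] E), ∀ p X, L p X = Φ p (covDeriv θ μ p X)) ∧
    ∀ Φ : G × E → ((E →L[ℝ] ℝ) ≃L[ℝ] E), (∀ p X, L p X = Φ p (covDeriv θ μ p X)) →
      ((∃ (g : Metric E G) (κ : DiffForm (IP E) (M := G × E) 2),
          IsInvariantKahler (cplx θ L) g κ ∧ IsMomentMap μ κ) ↔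
        ∀ p, SymmForm (Φ p : (E →L[ℝ] ℝ) →L[ℝ] E) ∧
          PosDefForm (Φ p : (E →L[ℝ] ℝ) →L[ℝ] E) ∧
          PosDefForm ((Φ p : (E →L[ℝ] ℝ) →L[ℝ] E) +
            (Φ p : (E →L[ℝ] ℝ) →L[ℝ] E).comp
              (((ad G (μ p)).comp (Φ p : (E →L[ℝ] ℝ) →L[ℝ] E)) ^ 2))) ∧
      ∀ (g : Metric E G) (κ : DiffForm (IP E) (M := G × E) 2),
        IsInvariantKahler (cplx θ L) g κ → IsMomentMap μ κ →
          (∀ p (X Y : TP p), g.inner p X Y =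
            (covDeriv θ μ p Y) (Φ p (covDeriv θ μ p X)) + ((Φ p).symm (θ p X)) (θ p Y)
              + μ p (lieBr G (Φ p (covDeriv θ μ p X)) (θ p Y)
                  - lieBr G (θ p X) (Φ p (covDeriv θ μ p Y)))) ∧
          κ = -(pairing μ θ).d := by
  have h := isComplexFraming_of_forms hθ hL
  refine ⟨?_, fun Φ hLΦ => ?_⟩
  · choose Φ hΦ using fun p => exists_isLegendre h hμ p (hreg p)
    exact ⟨Φ, hΦ, fun Φ' hΦ' => funext fun p => IsLegendre.unique h (hΦ' p) (hΦ p)⟩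
  have hΦ : ∀ p, IsLegendre (G := G) θ L μ p (Φ p) := hLΦ
  refine ⟨⟨?_, fun H => ?_⟩, fun g κ hg hκ => ⟨fun p X Y => ?_, ?_⟩⟩
  · rintro ⟨g, κ, hg, hκ⟩ p
    have hs := (hΦ p).symm_of_momentMetric_symm h (momentMetric_symm_of_inner h hg hκ p)
    refine ⟨(symmForm_iff_symm _).2 hs, ((hΦ p).momentMetric_pos_iff h hs).1 fun X hX => ?_⟩
    exact lt_of_lt_of_eq (g.pos p X hX) (inner_eq_momentMetric h hg hκ p X X)
  · have hs (p : G × E) := (symmForm_iff_symm _).1 (H p).1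
    have hsymm (p : G × E) := (hΦ p).momentMetric_symm h (hs p)
    have hpos (p : G × E) := ((hΦ p).momentMetric_pos_iff h (hs p)).2 (H p).2
    -- The Kähler form left to unification is −d⟨μ,θ⟩.
    exact ⟨kahlerMetric h hμ hsymm hpos, _,
      isInvariantKahler_kahlerMetric h hμ hI hΦ hs hsymm hpos,
      isMomentMap_neg_d_pairing h hμ hI hΦ hs⟩
  · have hs := (hΦ p).symm_of_momentMetric_symm h (momentMetric_symm_of_inner h hg hκ p)
    refine (inner_eq_momentMetric h hg hκ p X Y).trans (((hΦ p).momentMetric_eq h X Y).trans ?_)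
    have hY : covDeriv θ μ p Y = (Φ p).symm (L p Y) := by
      rw [hLΦ p Y, ContinuousLinearEquiv.symm_apply_apply]
    rw [← hLΦ, ← hLΦ, hY, map_sub]
    -- The stated formula has the arguments of Φ⁻¹(θX, θY) in the opposite order; symmetry of Φ
    -- reconciles them.
    exact congrArg₂ (· + ·) (congrArg₂ (· + ·) rfl (hs _ _)) rfl
  · exact kahlerForm_eq_neg_d_pairing h hμ hI hΦ hg hκ
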